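/- Let $N\ge 3$ and let $q>0$ be real, $q\ne1$. Write $i'=N+1-i$; let $\varrho_i=\frac N2-i$, $0$, $\frac N2-i+1$ according as $i<\frac{N+1}2$, $i=\frac{N+1}2$, $i>\frac{N+1}2$. Denote by $(P)$ the number $1$ if $P$ holds and $0$ otherwise, and put, for $1\le i,j,k,l\le N$, $$C^{ij}=C_{ij}=q^{-\varrho_i}(i=j'),\qquad K^{kl}_{ij}=C^{ij}C_{kl},$$ $$\hat R^{kl}_{ij}=q^{(k=l)-(k=l')}(i=l)(j=k)+(q-q^{-1})(i<l)\bigl((i=k)(j=l)-K^{kl}_{ij}\bigr),\qquad \hat R^{-}=\hat R-(q-q^{-1})I+(q-q^{-1})K .$$ Repeated upper and lower indices are summed from $1$ to $N$. Let $\mathrm O_q(N)$ be the complex bialgebra with generators $u^i_j$, relations $\hat R^{ij}_{mn}u^m_ku^n_l=u^i_mu^j_n\hat R^{mn}_{kl}$, $\sum_{k,l} C^{kl}u^i_ku^j_l=C^{ij}$, $\sum_{i,j} C_{ij}u^i_ku^j_l=C_{kl}$, and $\Delta u^i_j=u^i_k\otimes u^k_j$, $\varepsilon(u^i_j)=\delta_{ij}$.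 Let $X$ (the quantum Euclidean sphere) be the complex algebra with generators $x_1,\dots,x_N$ and relations $$(\hat R^{-})^{kl}_{ij}x_kx_l=q^{-1}x_ix_j+\frac{q^{N-1}-q^{N-3}}{1+q^{N-2}}K^{kl}_{ij}x_kx_l,\qquad C^{kl}x_kx_l=1,$$ with the coaction $\Delta_R:X\to X\otimes \mathrm O_q(N)$, $x_k\mapsto x_i\otimes u^i_k$ (an algebra homomorphism). A first order differential calculus on $X$ is an $X$-bimodule $\Gamma$ with a linear map $d:X\to\Gamma$ such that $d(xy)=dx\cdot y+x\,dy$ and $\Gamma=\mathrm{Lin}\{x\,dy\}$. It is covariant if there is a (necessarily unique) linear map $\Phi:\Gamma\to\Gamma\otimes \mathrm O_q(N)$ with $\Phi(dx)=(d\otimes\mathrm{id})\Delta_R(x)$, $\Phi(x\omega y)=\Delta_R(x)\Phi(\omega)\Delta_R(y)$, $(\Phi\otimes\mathrm{id})\Phi=(\mathrm{id}\otimes\Delta)\Phi$, $(\mathrm{id}\otimes\varepsilon)\Phi=\mathrm{id}$; a one-form $\omega$ is invariant if $\Phi(\omega)=\omega\otimes1$. A covariant calculus is inner if there is an invariant one-form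 $\omega_0$ with $dx=\omega_0x-x\omega_0$ for all $x\in X$. It is free if $dx_1,\dots,dx_N$ is a basis of $\Gamma$ as a left $X$-module. Denote by $\Gamma_+$ (upper signs) and $\Gamma_-$ (lower signs) the free covariant calculi with bimodule structure $$dx_i\cdot x_j=\pm(\hat R^{-})^{kl}_{ij}x_k\,dx_l+(\pm q-1)x_i\,dx_j+\frac{q^N-q^{N-2}}{1\mp q^{N-1}}K^{kl}_{ij}x_k\,dx_l+\frac{(1\mp q)(1+q^{N-2})}{1\mp q^{N-1}}C^{kl}x_ix_jx_k\,dx_l .\qquad(*)$$ **Statement.** Let $\Gamma$ be $\Gamma_+$ or $\Gamma_-$ (that is, any free covariant calculus satisfying $(*)$ with the corresponding signs), let $\eta=C^{kl}x_k\,dx_l$ and $$\eta'=\pm q\,\frac{1+q^{N-2}}{(1\mp q)(1\mp q^{N-1})}\,\eta .$$ Then $\eta$ and $\eta'$ are invariant and $dx=\eta'x-x\eta'$ for all $x\in X$. Hence $\Gamma_+$ and $\Gamma_-$ are inner. The same holds for the calculus presented by generators and relations, i.e. for the $X$-bimodule generated by symbols $dx$ ($x\in X$) subject to linearity of $d$,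 the Leibniz rule and $(*)$: it is covariant, $\eta$ and $\eta'$ are invariant, $dx=\eta'x-x\eta'$ for all $x\in X$, and it is inner. -/

import Mathlib

open scoped TensorProduct
open MulOpposite (op)

noncomputable section

namespace QSphere

/-! ## First order differential calculi over an algebra, covariance, inner calculi -/

section Calculus

variable (k : Type*) [Field k] (X : Type*) [Ring X] [Algebra k X]
  (Γ : Type*) [AddCommGroup Γ] [Module k Γ] [Module X Γ] [Module Xᵐᵒᵖ Γ]
  [IsScalarTower k X Γ] [IsScalarTower k Xᵐᵒᵖ Γ] [SMulCommClass X Xᵐᵒᵖ Γ]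

/-- A first order differential calculus `(Γ, d)` on the algebra `X`: here `Γ` is an `X`-bimodule
(the right action of `y` is `op y • ·`), `d` is linear, satisfies the Leibniz rule, and
`d X` spans `Γ` as a left module. -/
structure FODC where
  d : X →ₗ[k] Γ
  leibniz : ∀ x y : X, d (x * y) = op y • d x + x • d y
  span_eq_top : Submodule.span X (Set.range d) = ⊤

/-- The left action of `X ⊗ A` on `Γ ⊗ A`: `(x ⊗ a) (ω ⊗ b) = x ω ⊗ a b`. -/
def leftMul (A : Type*) [Ring A] [Algebra k A] :
    (X ⊗[k] A) →ₗ[k] (Γ ⊗[k] A) →ₗ[k] (Γ ⊗[k] A) :=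
  TensorProduct.map₂ (Algebra.lsmul k k Γ : X →ₐ[k] Module.End k Γ).toLinearMap
    (LinearMap.mul k A)

/-- The right action of `X ⊗ A` on `Γ ⊗ A`: `(ω ⊗ b) (x ⊗ a) = ω x ⊗ b a`.
The acting element is the first argument. -/
def rightMul (A : Type*) [Ring A] [Algebra k A] :
    (X ⊗[k] A) →ₗ[k] (Γ ⊗[k] A) →ₗ[k] (Γ ⊗[k] A) :=
  TensorProduct.map₂
    ((Algebra.lsmul k k Γ : Xᵐᵒᵖ →ₐ[k] Module.End k Γ).toLinearMap ∘ₗ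
      (MulOpposite.opLinearEquiv k : X ≃ₗ[k] Xᵐᵒᵖ).toLinearMap)
    (LinearMap.mul k A).flip

variable {k X Γ}
variable {A : Type*} [Ring A] [Bialgebra k A]

/-- `Φ : Γ → Γ ⊗ A` is the covariance map of the calculus `c` with respect to the coaction
`δ : X → X ⊗ A`: `Φ (d x) = (d ⊗ id) (δ x)`, `Φ (x ω y) = δ x · Φ ω · δ y`, and `Φ` is
coassociative and counital. -/
structure FODC.IsCovarianceMap (c : FODC k X Γ) (δ : X →ₐ[k] X ⊗[k] A)
    (Φ : Γ →ₗ[k] Γ ⊗[k] A) : Prop where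
  map_d : ∀ x : X, Φ (c.d x) = c.d.rTensor A (δ x)
  map_smul : ∀ (x y : X) (ω : Γ),
    Φ (x • op y • ω) = leftMul k X Γ A (δ x) (rightMul k X Γ A (δ y) (Φ ω))
  coassoc : ∀ ω : Γ, TensorProduct.assoc k Γ A A (Φ.rTensor A (Φ ω)) =
    (Coalgebra.comul : A →ₗ[k] A ⊗[k] A).lTensor Γ (Φ ω)
  counit : ∀ ω : Γ, TensorProduct.rid k Γ
    ((Coalgebra.counit : A →ₗ[k] k).lTensor Γ (Φ ω)) = ω

/-- The calculus is covariant: the map `Φ` exists (it is unique, as `d X` spans `Γ`). -/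
def FODC.IsCovariant (c : FODC k X Γ) (δ : X →ₐ[k] X ⊗[k] A) : Prop :=
  ∃ Φ : Γ →ₗ[k] Γ ⊗[k] A, c.IsCovarianceMap δ Φ

/-- The one-form `ω` is invariant for the covariance map `Φ`. -/
def IsInvariant (Φ : Γ →ₗ[k] Γ ⊗[k] A) (ω : Γ) : Prop := Φ ω = ω ⊗ₜ[k] (1 : A)

/-- A covariant calculus is inner if there is an invariant one-form `ω₀` such that
`d x = ω₀ x - x ω₀` for all `x`. -/
def FODC.IsInner (c : FODC k X Γ) (δ : X →ₐ[k] X ⊗[k] A) : Prop :=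
  ∃ Φ : Γ →ₗ[k] Γ ⊗[k] A, c.IsCovarianceMap δ Φ ∧
    ∃ ω₀ : Γ, IsInvariant Φ ω₀ ∧ ∀ x : X, c.d x = op x • ω₀ - x • ω₀

end Calculus

/-! ## The structure constants

The index set `{1, …, N}` is `Fin N`, the element `i : Fin N` standing for the index `i + 1`;
the involution `i ↦ i' = N + 1 - i` is `Fin.rev`. -/

variable {N : ℕ}

/-- The numbers `ϱ_i` (`N/2 - i`, `0`, `N/2 - i + 1` for `i` less than, equal to, greater than
`(N+1)/2`, in one-based numbering). -/
def rho (i : Fin N) : ℝ :=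
  if 2 * (i : ℕ) + 1 < N then (N : ℝ) / 2 - ((i : ℕ) + 1)
  else if 2 * (i : ℕ) + 1 = N then 0
  else (N : ℝ) / 2 - ((i : ℕ) + 1) + 1

/-- `C^{ij} = C_{ij} = q^{-ϱ_i} (i = j')`. -/
def C (q : ℝ) (i j : Fin N) : ℝ := if i = j.rev then q ^ (-rho i) else 0

/-- `K q k l i j` is `K^{kl}_{ij} = C^{ij} C_{kl}`. -/
def K (q : ℝ) (k l i j : Fin N) : ℝ := C q i j * C q k l

/-- `R q k l i j` is the entry `R̂^{kl}_{ij}` of the R-matrix of `O_q(N)`. -/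
def R (q : ℝ) (k l i j : Fin N) : ℝ :=
  q ^ ((if k = l then 1 else 0) - (if k = l.rev then 1 else 0) : ℤ) *
      (if i = l then 1 else 0) * (if j = k then 1 else 0)
    + (q - q⁻¹) * (if i < l then 1 else 0) *
      ((if i = k then 1 else 0) * (if j = l then 1 else 0) - K q k l i j)

/-- `Rm q k l i j` is the entry `(R̂⁻¹)^{kl}_{ij}` of
`R̂⁻¹ = R̂ - (q - q⁻¹) I + (q - q⁻¹) K`. -/
def Rm (q : ℝ) (k l i j : Fin N) : ℝ :=
  R q k l i j - (q - q⁻¹) * ((if i = k then 1 else 0) * (if j = l then 1 else 0))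
    + (q - q⁻¹) * K q k l i j

/-! ## The quantum Euclidean sphere -/

/-- The defining relations of the sphere, on words in the free generators. -/
inductive SphereRel (N : ℕ) (q : ℝ) :
    FreeAlgebra ℂ (Fin N) → FreeAlgebra ℂ (Fin N) → Prop
  | comm (i j : Fin N) : SphereRel N q
      (∑ k, ∑ l, (Rm q k l i j : ℂ) • (FreeAlgebra.ι ℂ k * FreeAlgebra.ι ℂ l))
      (((q⁻¹ : ℝ) : ℂ) • (FreeAlgebra.ι ℂ i * FreeAlgebra.ι ℂ j) +
        (((q ^ (N - 1) - q ^ (N - 3)) / (1 + q ^ (N - 2)) : ℝ) : ℂ) •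
          ∑ k, ∑ l, (K q k l i j : ℂ) • (FreeAlgebra.ι ℂ k * FreeAlgebra.ι ℂ l))
  | unit : SphereRel N q
      (∑ k, ∑ l, (C q k l : ℂ) • (FreeAlgebra.ι ℂ k * FreeAlgebra.ι ℂ l)) 1

/-- The coordinate algebra of the quantum Euclidean sphere `S_q^{N-1}`. -/
def Sphere (N : ℕ) (q : ℝ) : Type := RingQuot (SphereRel N q)

namespace Sphere

variable {q : ℝ}

instance : Ring (Sphere N q) := inferInstanceAs (Ring (RingQuot (SphereRel N q)))
instance : Algebra ℂ (Sphere N q) := inferInstanceAs (Algebra ℂ (RingQuot (SphereRel N q)))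

/-- The quotient map from the free algebra. -/
def mk (N : ℕ) (q : ℝ) : FreeAlgebra ℂ (Fin N) →ₐ[ℂ] Sphere N q :=
  RingQuot.mkAlgHom ℂ (SphereRel N q)

/-- The generators `x_i`. -/
def x (q : ℝ) (i : Fin N) : Sphere N q := mk N q (FreeAlgebra.ι ℂ i)

/-- The universal property of the generators and relations. -/
def lift {B : Type*} [Ring B] [Algebra ℂ B] (f : FreeAlgebra ℂ (Fin N) →ₐ[ℂ] B)
    (h : ∀ a b, SphereRel N q a b → f a = f b) : Sphere N q →ₐ[ℂ] B :=
  RingQuot.liftAlgHom ℂ ⟨f, fun a b hab => h a b hab⟩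

end Sphere

theorem sphere_comm {N : ℕ} (q : ℝ) (i j : Fin N) :
    ∑ k, ∑ l, (Rm q k l i j : ℂ) • (Sphere.x q k * Sphere.x q l) =
      ((q⁻¹ : ℝ) : ℂ) • (Sphere.x q i * Sphere.x q j) +
        (((q ^ (N - 1) - q ^ (N - 3)) / (1 + q ^ (N - 2)) : ℝ) : ℂ) •
          ∑ k, ∑ l, (K q k l i j : ℂ) • (Sphere.x q k * Sphere.x q l) := by
  have h := RingQuot.mkAlgHom_rel ℂ (SphereRel.comm (N := N) (q := q) i j)
  change Sphere.mk N q _ = Sphere.mk N q _ at h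
  simpa only [map_sum, map_smul, map_mul, map_add, map_one, Sphere.x] using h

theorem sphere_unit {N : ℕ} (q : ℝ) :
    ∑ k : Fin N, ∑ l, (C q k l : ℂ) • (Sphere.x q k * Sphere.x q l) = 1 := by
  have h := RingQuot.mkAlgHom_rel ℂ (SphereRel.unit (N := N) (q := q))
  change Sphere.mk N q _ = Sphere.mk N q _ at h
  simpa only [map_sum, map_smul, map_mul, map_add, map_one, Sphere.x] using h

/-! ## The quantum group `O_q(N)` -/

/-- The defining relations of `O_q(N)`; the free generator `(i, j)` stands for `u^i_j`. -/
inductive OqRel (N : ℕ) (q : ℝ) :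
    FreeAlgebra ℂ (Fin N × Fin N) → FreeAlgebra ℂ (Fin N × Fin N) → Prop
  | rtt (i j k l : Fin N) : OqRel N q
      (∑ m, ∑ n, (R q i j m n : ℂ) • (FreeAlgebra.ι ℂ (m, k) * FreeAlgebra.ι ℂ (n, l)))
      (∑ m, ∑ n, (R q m n k l : ℂ) • (FreeAlgebra.ι ℂ (i, m) * FreeAlgebra.ι ℂ (j, n)))
  | orth (i j : Fin N) : OqRel N q
      (∑ k, ∑ l, (C q k l : ℂ) • (FreeAlgebra.ι ℂ (i, k) * FreeAlgebra.ι ℂ (j, l)))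
      (algebraMap ℂ _ (C q i j : ℂ))
  | orth' (k l : Fin N) : OqRel N q
      (∑ i, ∑ j, (C q i j : ℂ) • (FreeAlgebra.ι ℂ (i, k) * FreeAlgebra.ι ℂ (j, l)))
      (algebraMap ℂ _ (C q k l : ℂ))

/-- The coordinate algebra of the quantum group `O_q(N)`. -/
def Oq (N : ℕ) (q : ℝ) : Type := RingQuot (OqRel N q)

namespace Oq

variable {q : ℝ}

instance : Ring (Oq N q) := inferInstanceAs (Ring (RingQuot (OqRel N q)))
instance : Algebra ℂ (Oq N q) := inferInstanceAs (Algebra ℂ (RingQuot (OqRel N q)))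

/-- The quotient map from the free algebra. -/
def mk (N : ℕ) (q : ℝ) : FreeAlgebra ℂ (Fin N × Fin N) →ₐ[ℂ] Oq N q :=
  RingQuot.mkAlgHom ℂ (OqRel N q)

/-- The matrix entries `u^i_j`. -/
def u (q : ℝ) (i j : Fin N) : Oq N q := mk N q (FreeAlgebra.ι ℂ (i, j))

/-- The universal property of the generators and relations. -/
def lift {B : Type*} [Ring B] [Algebra ℂ B] (f : FreeAlgebra ℂ (Fin N × Fin N) →ₐ[ℂ] B)
    (h : ∀ a b, OqRel N q a b → f a = f b) : Oq N q →ₐ[ℂ] B :=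
  RingQuot.liftAlgHom ℂ ⟨f, fun a b hab => h a b hab⟩

theorem lift_u {B : Type*} [Ring B] [Algebra ℂ B] (f : FreeAlgebra ℂ (Fin N × Fin N) →ₐ[ℂ] B)
    (h : ∀ a b, OqRel N q a b → f a = f b) (i j : Fin N) :
    lift f h (u q i j) = f (FreeAlgebra.ι ℂ (i, j)) :=
  RingQuot.liftAlgHom_mkAlgHom_apply ℂ f (fun a b hab => h a b hab) _

theorem hom_ext {B : Type*} [Ring B] [Algebra ℂ B] {f g : Oq N q →ₐ[ℂ] B}
    (h : ∀ i j, f (u q i j) = g (u q i j)) : f = g := by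
  refine RingQuot.ringQuot_ext' ℂ _ _ (FreeAlgebra.hom_ext (funext fun p => ?_))
  exact h p.1 p.2

theorem rtt (i j k l : Fin N) :
    ∑ m, ∑ n, (R q i j m n : ℂ) • (u q m k * u q n l) =
      ∑ m, ∑ n, (R q m n k l : ℂ) • (u q i m * u q j n) := by
  have h := RingQuot.mkAlgHom_rel ℂ (OqRel.rtt (N := N) (q := q) i j k l)
  change mk N q _ = mk N q _ at h
  simpa only [map_sum, map_smul, map_mul, AlgHom.commutes, u] using h

theorem orth (i j : Fin N) :
    ∑ k, ∑ l, (C q k l : ℂ) • (u q i k * u q j l) = algebraMap ℂ _ (C q i j : ℂ) := by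
  have h := RingQuot.mkAlgHom_rel ℂ (OqRel.orth (N := N) (q := q) i j)
  change mk N q _ = mk N q _ at h
  simpa only [map_sum, map_smul, map_mul, AlgHom.commutes, u] using h

theorem orth' (k l : Fin N) :
    ∑ i, ∑ j, (C q i j : ℂ) • (u q i k * u q j l) = algebraMap ℂ _ (C q k l : ℂ) := by
  have h := RingQuot.mkAlgHom_rel ℂ (OqRel.orth' (N := N) (q := q) k l)
  change mk N q _ = mk N q _ at h
  simpa only [map_sum, map_smul, map_mul, AlgHom.commutes, u] using h

theorem sum_smul_comm {ι M : Type*} [Fintype ι] [AddCommGroup M] [Module ℂ M]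
    (f : ι → ι → ℂ) (g : ι → ι → ι → ι → M) :
    ∑ m, ∑ n, f m n • ∑ a, ∑ b, g m n a b = ∑ a, ∑ b, ∑ m, ∑ n, f m n • g m n a b := by
  simp only [Finset.smul_sum]
  rw [← Finset.sum_product', Finset.sum_congr rfl (fun _ _ => (Finset.sum_product' _ _ _).symm),
    Finset.sum_comm, Finset.sum_product]
  simp only [Finset.sum_product]

/-- The comultiplication on free generators, `u^i_j ↦ ∑ u^i_k ⊗ u^k_j`. -/
def comulFree (N : ℕ) (q : ℝ) : FreeAlgebra ℂ (Fin N × Fin N) →ₐ[ℂ] Oq N q ⊗[ℂ] Oq N q :=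
  FreeAlgebra.lift ℂ fun p => ∑ k, u q p.1 k ⊗ₜ[ℂ] u q k p.2

theorem comulFree_mul (i j k l : Fin N) :
    comulFree N q (FreeAlgebra.ι ℂ (i, k) * FreeAlgebra.ι ℂ (j, l)) =
      ∑ a, ∑ b, (u q i a * u q j b) ⊗ₜ[ℂ] (u q a k * u q b l) := by
  simp [comulFree, Finset.sum_mul_sum]

theorem comulFree_rel (a b : FreeAlgebra ℂ (Fin N × Fin N)) (h : OqRel N q a b) :
    comulFree N q a = comulFree N q b := by
  induction h with
  | rtt i j k l =>
    simp only [map_sum, map_smul, comulFree_mul]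
    rw [sum_smul_comm, sum_smul_comm]
    simp only [← TensorProduct.tmul_smul]
    have h1 : ∀ a b : Fin N, ∑ m, ∑ n, (R q i j m n : ℂ) • (u q m a * u q n b) ⊗ₜ[ℂ]
        (u q a k * u q b l) = ∑ m, ∑ n, (R q m n a b : ℂ) • (u q i m * u q j n) ⊗ₜ[ℂ]
        (u q a k * u q b l) := by
      intro a b
      simp only [TensorProduct.smul_tmul', ← TensorProduct.sum_tmul]
      rw [rtt]
    have h2 : ∀ a b : Fin N, ∑ m, ∑ n, (u q i a * u q j b) ⊗ₜ[ℂ]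
        ((R q m n k l : ℂ) • (u q a m * u q b n)) = ∑ m, ∑ n, (u q i a * u q j b) ⊗ₜ[ℂ]
        ((R q a b m n : ℂ) • (u q m k * u q n l)) := by
      intro a b
      simp only [← TensorProduct.tmul_sum]
      rw [rtt]
    simp only [h2]
    simp only [TensorProduct.tmul_smul, h1]
    have := sum_smul_comm (fun _ _ : Fin N => (1 : ℂ)) (fun a b m n =>
      (R q m n a b : ℂ) • (u q i m * u q j n) ⊗ₜ[ℂ] (u q a k * u q b l))
    simpa using this
  | orth i j =>
    simp only [map_sum, map_smul, comulFree_mul]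
    rw [sum_smul_comm]
    simp only [← TensorProduct.tmul_smul, ← TensorProduct.tmul_sum, orth]
    simp only [Algebra.algebraMap_eq_smul_one, TensorProduct.tmul_smul,
      TensorProduct.smul_tmul', ← TensorProduct.sum_tmul, orth, map_smul, map_one]
    rfl
  | orth' k l =>
    simp only [map_sum, map_smul, comulFree_mul]
    rw [sum_smul_comm]
    simp only [TensorProduct.smul_tmul', ← TensorProduct.sum_tmul, orth']
    simp only [Algebra.algebraMap_eq_smul_one, ← TensorProduct.smul_tmul',
      ← TensorProduct.tmul_smul, ← TensorProduct.tmul_sum, orth', map_smul, map_one]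
    simp only [TensorProduct.tmul_smul]
    rfl

/-- The comultiplication as an algebra homomorphism. -/
def comulHom (N : ℕ) (q : ℝ) : Oq N q →ₐ[ℂ] Oq N q ⊗[ℂ] Oq N q :=
  lift (comulFree N q) comulFree_rel

theorem comulHom_u (i j : Fin N) :
    comulHom N q (u q i j) = ∑ k, u q i k ⊗ₜ[ℂ] u q k j := by
  simp [comulHom, lift_u, comulFree]

/-- The counit on free generators, `u^i_j ↦ δ_{ij}`. -/
def counitFree (N : ℕ) : FreeAlgebra ℂ (Fin N × Fin N) →ₐ[ℂ] ℂ :=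
  FreeAlgebra.lift ℂ fun p => if p.1 = p.2 then 1 else 0

theorem counitFree_rel (a b : FreeAlgebra ℂ (Fin N × Fin N)) (h : OqRel N q a b) :
    counitFree N a = counitFree N b := by
  induction h with
  | rtt i j k l =>
    simp only [counitFree, map_sum, map_smul, map_mul, FreeAlgebra.lift_ι_apply]
    simp
  | orth i j =>
    simp only [counitFree, map_sum, map_smul, map_mul, FreeAlgebra.lift_ι_apply, AlgHom.commutes]
    simp
  | orth' k l =>
    simp only [counitFree, map_sum, map_smul, map_mul, FreeAlgebra.lift_ι_apply, AlgHom.commutes]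
    simp

/-- The counit as an algebra homomorphism. -/
def counitHom (N : ℕ) (q : ℝ) : Oq N q →ₐ[ℂ] ℂ := lift (counitFree N) counitFree_rel

theorem counitHom_u (i j : Fin N) : counitHom N q (u q i j) = if i = j then 1 else 0 := by
  simp [counitHom, lift_u, counitFree]

/-- The bialgebra structure of `O_q(N)`: `Δ u^i_j = ∑ u^i_k ⊗ u^k_j`, `ε u^i_j = δ_{ij}`.
(Antipode and universal r-form are determined by it and play no role for covariance.) -/
instance : Bialgebra ℂ (Oq N q) :=
  Bialgebra.ofAlgHom (comulHom N q) (counitHom N q)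
    (by
      refine hom_ext fun i j => ?_
      simp only [AlgHom.comp_apply, comulHom_u, map_sum, Algebra.TensorProduct.map_tmul,
        TensorProduct.sum_tmul, TensorProduct.tmul_sum, AlgHom.id_apply]
      rw [Finset.sum_comm]
      rfl)
    (by
      refine hom_ext fun i j => ?_
      simp [comulHom_u, counitHom_u, TensorProduct.ite_tmul])
    (by
      refine hom_ext fun i j => ?_
      simp [comulHom_u, counitHom_u, TensorProduct.tmul_ite])

end Oq

/-! ## The coaction of `O_q(N)` on the sphere -/

/-- The coaction on free generators, `x_k ↦ ∑ x_i ⊗ u^i_k`. -/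
def coactionFree (N : ℕ) (q : ℝ) : FreeAlgebra ℂ (Fin N) →ₐ[ℂ] Sphere N q ⊗[ℂ] Oq N q :=
  FreeAlgebra.lift ℂ fun k => ∑ i, Sphere.x q i ⊗ₜ[ℂ] Oq.u q i k

theorem coactionFree_mul {q : ℝ} (k l : Fin N) :
    coactionFree N q (FreeAlgebra.ι ℂ k * FreeAlgebra.ι ℂ l) =
      ∑ a, ∑ b, (Sphere.x q a * Sphere.x q b) ⊗ₜ[ℂ] (Oq.u q a k * Oq.u q b l) := by
  simp [coactionFree, Finset.sum_mul_sum]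

theorem sum_R_u {q : ℝ} (a b i j : Fin N) :
    ∑ k, ∑ l, (Rm q k l i j : ℂ) • (Oq.u q a k * Oq.u q b l) =
      ∑ k, ∑ l, (Rm q a b k l : ℂ) • (Oq.u q k i * Oq.u q l j) := by
  have h := Oq.rtt (q := q) a b i j
  have h3 : ∑ k, ∑ l, (K q k l i j : ℂ) • (Oq.u q a k * Oq.u q b l) =
      ∑ k, ∑ l, (K q a b k l : ℂ) • (Oq.u q k i * Oq.u q l j) := by
    have e1 := congrArg (fun z => (C q i j : ℂ) • z) (Oq.orth (q := q) a b)
    have e2 := congrArg (fun z => (C q a b : ℂ) • z) (Oq.orth' (q := q) i j)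
    simp only [Finset.smul_sum, smul_smul, Algebra.algebraMap_eq_smul_one] at e1 e2
    simp only [K, Complex.ofReal_mul]
    rw [e1, mul_comm, ← e2]
    simp only [mul_comm]
  have h2 : ∑ k, ∑ l, ((if i = k then 1 else 0) * (if j = l then 1 else 0) : ℂ) •
        (Oq.u q a k * Oq.u q b l) =
      ∑ k, ∑ l, ((if k = a then 1 else 0) * (if l = b then 1 else 0) : ℂ) •
        (Oq.u q k i * Oq.u q l j) := by
    simp
  have e : ∀ k l i j : Fin N, (Rm q k l i j : ℂ) = (R q k l i j : ℂ) -
      ((q - q⁻¹ : ℝ) : ℂ) * ((if i = k then 1 else 0) * (if j = l then 1 else 0)) +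
      ((q - q⁻¹ : ℝ) : ℂ) * (K q k l i j : ℂ) := by
    intro k l i j
    simp only [Rm]
    push_cast
    split_ifs <;> simp
  simp only [e, add_smul, sub_smul, mul_smul ((q - q⁻¹ : ℝ) : ℂ), Finset.sum_add_distrib,
    Finset.sum_sub_distrib, ← Finset.smul_sum, h, h2, h3]

theorem coactionFree_rel {q : ℝ} (a b : FreeAlgebra ℂ (Fin N)) (h : SphereRel N q a b) :
    coactionFree N q a = coactionFree N q b := by
  have hK : ∀ i j : Fin N, ∑ k, ∑ l, (K q k l i j : ℂ) •
      ∑ a, ∑ b, (Sphere.x q a * Sphere.x q b) ⊗ₜ[ℂ] (Oq.u q a k * Oq.u q b l) =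
      (C q i j : ℂ) • (1 : Sphere N q ⊗[ℂ] Oq N q) := by
    intro i j
    rw [Oq.sum_smul_comm]
    simp only [K, Complex.ofReal_mul, mul_smul, ← Finset.smul_sum]
    congr 1
    simp only [← TensorProduct.tmul_smul, ← TensorProduct.tmul_sum, Oq.orth]
    simp only [Algebra.algebraMap_eq_smul_one, TensorProduct.tmul_smul,
      TensorProduct.smul_tmul', ← TensorProduct.sum_tmul, sphere_unit]
    rfl
  induction h with
  | comm i j =>
    simp only [map_sum, map_smul, map_add, coactionFree_mul, hK]
    rw [Oq.sum_smul_comm]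
    simp only [← TensorProduct.tmul_smul, ← TensorProduct.tmul_sum, sum_R_u]
    have e := Oq.sum_smul_comm (fun _ _ : Fin N => (1 : ℂ)) (fun a b k l =>
      (Rm q a b k l : ℂ) • (Sphere.x q a * Sphere.x q b) ⊗ₜ[ℂ] (Oq.u q k i * Oq.u q l j))
    simp only [one_smul] at e
    simp only [TensorProduct.tmul_sum, TensorProduct.tmul_smul]
    rw [e]
    simp only [TensorProduct.smul_tmul', ← TensorProduct.sum_tmul, sphere_comm]
    simp only [K, Complex.ofReal_mul, mul_smul, ← Finset.smul_sum, sphere_unit,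
      TensorProduct.add_tmul, Finset.sum_add_distrib, ← TensorProduct.smul_tmul']
    congr 2
    have e2 := congrArg (fun z => (1 : Sphere N q) ⊗ₜ[ℂ] z) (Oq.orth' (q := q) i j)
    simp only [TensorProduct.tmul_sum, TensorProduct.tmul_smul,
      Algebra.algebraMap_eq_smul_one] at e2
    exact e2
  | unit =>
    simp only [map_sum, map_smul, map_one, coactionFree_mul]
    rw [Oq.sum_smul_comm]
    simp only [← TensorProduct.tmul_smul, ← TensorProduct.tmul_sum, Oq.orth]
    simp only [Algebra.algebraMap_eq_smul_one, TensorProduct.tmul_smul,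
      TensorProduct.smul_tmul', ← TensorProduct.sum_tmul, sphere_unit]
    rfl

/-- The right coaction `Δ_R : X → X ⊗ O_q(N)`, `x_k ↦ ∑ x_i ⊗ u^i_k`. -/
def coaction (N : ℕ) (q : ℝ) : Sphere N q →ₐ[ℂ] Sphere N q ⊗[ℂ] Oq N q :=
  Sphere.lift (coactionFree N q) coactionFree_rel

theorem coaction_x {q : ℝ} (k : Fin N) :
    coaction N q (Sphere.x q k) = ∑ i, Sphere.x q i ⊗ₜ[ℂ] Oq.u q i k := by
  refine (RingQuot.liftAlgHom_mkAlgHom_apply ℂ (coactionFree N q) coactionFree_rel _).trans ?_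
  simp [coactionFree]

/-! ## The calculi `Γ₊` and `Γ₋`

The sign `±` is an element `s` of `ℤˣ = {1, -1}`; upper signs are `s = 1`, lower ones `s = -1`. -/

/-- The sign `s` as a real number. -/
def sgn (s : ℤˣ) : ℝ := ((s : ℤ) : ℝ)

section BimoduleStructure

variable {q : ℝ} {M : Type*} [AddCommGroup M] [Module ℂ M] [Module (Sphere N q) M]

/-- The right-hand side of the relation for `d x_i · x_j`:
`± R̂⁻¹^{kl}_{ij} x_k d x_l + (± q - 1) x_i d x_j`
`+ (q^N - q^{N-2}) / (1 ∓ q^{N-1}) K^{kl}_{ij} x_k d x_l`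
`+ (1 ∓ q) (1 + q^{N-2}) / (1 ∓ q^{N-1}) C^{kl} x_i x_j x_k d x_l`. -/
def bimoduleRHS (s : ℤˣ) (d : Sphere N q → M) (i j : Fin N) : M :=
  (sgn s : ℂ) • ∑ k, ∑ l, (Rm q k l i j : ℂ) • (Sphere.x q k • d (Sphere.x q l))
    + ((sgn s * q - 1 : ℝ) : ℂ) • (Sphere.x q i • d (Sphere.x q j))
    + (((q ^ N - q ^ (N - 2)) / (1 - sgn s * q ^ (N - 1)) : ℝ) : ℂ) •
        ∑ k, ∑ l, (K q k l i j : ℂ) • (Sphere.x q k • d (Sphere.x q l))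
    + (((1 - sgn s * q) * (1 + q ^ (N - 2)) / (1 - sgn s * q ^ (N - 1)) : ℝ) : ℂ) •
        ∑ k, ∑ l, (C q k l : ℂ) •
          ((Sphere.x q i * Sphere.x q j * Sphere.x q k) • d (Sphere.x q l))

variable [Module (Sphere N q)ᵐᵒᵖ M] [IsScalarTower ℂ (Sphere N q) M]
  [IsScalarTower ℂ (Sphere N q)ᵐᵒᵖ M] [SMulCommClass (Sphere N q) (Sphere N q)ᵐᵒᵖ M]

/-- The calculus has the bimodule structure of `Γ₊` (`s = 1`) or `Γ₋` (`s = -1`). -/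
def HasBimoduleStructure (s : ℤˣ) (c : FODC ℂ (Sphere N q) M) : Prop :=
  ∀ i j : Fin N, op (Sphere.x q j) • c.d (Sphere.x q i) = bimoduleRHS s c.d i j

/-- The calculus is free: `d x_1, …, d x_N` form a basis of the left module of one-forms. -/
def IsFree (c : FODC ℂ (Sphere N q) M) : Prop :=
  LinearIndependent (Sphere N q) (fun i : Fin N => c.d (Sphere.x q i)) ∧
    Submodule.span (Sphere N q) (Set.range fun i : Fin N => c.d (Sphere.x q i)) = ⊤

/-- The calculus is (a copy of) `Γ₊` (`s = 1`) or `Γ₋` (`s = -1`): the free covariant calculus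
with the corresponding bimodule structure. -/
structure IsGamma (s : ℤˣ) (c : FODC ℂ (Sphere N q) M) : Prop where
  free : IsFree c
  covariant : c.IsCovariant (coaction N q)
  bimodule : HasBimoduleStructure s c

/-- The one-form `η = C^{kl} x_k d x_l`. -/
def eta (c : FODC ℂ (Sphere N q) M) : M :=
  ∑ k, ∑ l, (C q k l : ℂ) • (Sphere.x q k • c.d (Sphere.x q l))

/-- The one-form `η' = ± q (1 + q^{N-2}) / ((1 ∓ q) (1 ∓ q^{N-1})) η`. -/
def eta' (s : ℤˣ) (c : FODC ℂ (Sphere N q) M) : M :=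
  ((sgn s * q * (1 + q ^ (N - 2)) / ((1 - sgn s * q) * (1 - sgn s * q ^ (N - 1))) : ℝ) : ℂ) •
    eta c

end BimoduleStructure

/-! ### Presentation of `Γ₊` and `Γ₋` by generators and relations

`Gamma N q s` is the bimodule generated by symbols `d x`, `x ∈ X`, subject to linearity of `d`,
the Leibniz rule and the relations for `d x_i · x_j`. Bimodules are modules over the enveloping
algebra `X ⊗ Xᵐᵒᵖ`, through which the left and the right action are defined. -/

/-- The enveloping algebra `X ⊗ Xᵐᵒᵖ`. -/
abbrev Env (N : ℕ) (q : ℝ) : Type := Sphere N q ⊗[ℂ] (Sphere N q)ᵐᵒᵖ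

/-- The left action of `X` in the enveloping algebra. -/
def envL (N : ℕ) (q : ℝ) : Sphere N q →ₐ[ℂ] Env N q := Algebra.TensorProduct.includeLeft

/-- The right action of `X` in the enveloping algebra, as an action of `Xᵐᵒᵖ`. -/
def envR (N : ℕ) (q : ℝ) : (Sphere N q)ᵐᵒᵖ →ₐ[ℂ] Env N q := Algebra.TensorProduct.includeRight

/-- The free bimodule on symbols `d x`, `x ∈ X`. -/
def FreeForms (N : ℕ) (q : ℝ) : Type := Sphere N q →₀ Env N q

namespace FreeForms

variable {q : ℝ}

instance : AddCommGroup (FreeForms N q) :=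
  inferInstanceAs (AddCommGroup (Sphere N q →₀ Env N q))
instance : Module (Env N q) (FreeForms N q) :=
  inferInstanceAs (Module (Env N q) (Sphere N q →₀ Env N q))
instance : Module ℂ (FreeForms N q) := inferInstanceAs (Module ℂ (Sphere N q →₀ Env N q))
instance : IsScalarTower ℂ (Env N q) (FreeForms N q) :=
  inferInstanceAs (IsScalarTower ℂ (Env N q) (Sphere N q →₀ Env N q))
instance : Module (Sphere N q) (FreeForms N q) :=
  Module.compHom (FreeForms N q) (envL N q).toRingHom
instance : Module (Sphere N q)ᵐᵒᵖ (FreeForms N q) :=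
  Module.compHom (FreeForms N q) (envR N q).toRingHom

/-- The symbol `d x`. -/
def symb (x : Sphere N q) : FreeForms N q := (Finsupp.single x 1 : Sphere N q →₀ Env N q)

end FreeForms

open FreeForms in
/-- The elements of the free bimodule that are set to zero in `Gamma N q s`. -/
inductive GammaRel (N : ℕ) (q : ℝ) (s : ℤˣ) : FreeForms N q → Prop
  | add (x y : Sphere N q) : GammaRel N q s (symb (x + y) - (symb x + symb y))
  | smul (a : ℂ) (x : Sphere N q) : GammaRel N q s (symb (a • x) - a • symb x)
  | leibniz (x y : Sphere N q) : GammaRel N q s (symb (x * y) - (op y • symb x + x • symb y))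
  | bimodule (i j : Fin N) : GammaRel N q s
      (op (Sphere.x q j) • symb (Sphere.x q i) - bimoduleRHS s symb i j)

/-- The sub-bimodule of relations. -/
def gammaRelations (N : ℕ) (q : ℝ) (s : ℤˣ) : Submodule (Env N q) (FreeForms N q) :=
  Submodule.span (Env N q) {z | GammaRel N q s z}

/-- The bimodule of one-forms of `Γ₊` (`s = 1`) and `Γ₋` (`s = -1`). -/
def Gamma (N : ℕ) (q : ℝ) (s : ℤˣ) : Type := FreeForms N q ⧸ gammaRelations N q s

namespace Gamma

variable {q : ℝ} {s : ℤˣ}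

instance : AddCommGroup (Gamma N q s) :=
  inferInstanceAs (AddCommGroup (FreeForms N q ⧸ gammaRelations N q s))
instance : Module (Env N q) (Gamma N q s) :=
  inferInstanceAs (Module (Env N q) (FreeForms N q ⧸ gammaRelations N q s))
instance : Module ℂ (Gamma N q s) :=
  inferInstanceAs (Module ℂ (FreeForms N q ⧸ gammaRelations N q s))
instance : IsScalarTower ℂ (Env N q) (Gamma N q s) :=
  inferInstanceAs (IsScalarTower ℂ (Env N q) (FreeForms N q ⧸ gammaRelations N q s))
instance : Module (Sphere N q) (Gamma N q s) :=
  Module.compHom (Gamma N q s) (envL N q).toRingHom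
instance : Module (Sphere N q)ᵐᵒᵖ (Gamma N q s) :=
  Module.compHom (Gamma N q s) (envR N q).toRingHom

theorem smul_def (x : Sphere N q) (ω : Gamma N q s) : x • ω = envL N q x • ω := rfl
theorem op_smul_def (x : (Sphere N q)ᵐᵒᵖ) (ω : Gamma N q s) : x • ω = envR N q x • ω := rfl

instance : IsScalarTower ℂ (Sphere N q) (Gamma N q s) :=
  ⟨fun a x ω => by rw [smul_def, smul_def, map_smul, smul_assoc]⟩
instance : IsScalarTower ℂ (Sphere N q)ᵐᵒᵖ (Gamma N q s) :=
  ⟨fun a x ω => by rw [op_smul_def, op_smul_def, map_smul, smul_assoc]⟩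
instance : SMulCommClass (Sphere N q) (Sphere N q)ᵐᵒᵖ (Gamma N q s) :=
  ⟨fun x y ω => by
    rw [smul_def, op_smul_def, op_smul_def, smul_def, ← mul_smul, ← mul_smul]
    congr 1
    simp [envL, envR]⟩

/-- The quotient map from the free bimodule. -/
def mk (N : ℕ) (q : ℝ) (s : ℤˣ) : FreeForms N q →ₗ[Env N q] Gamma N q s :=
  (gammaRelations N q s).mkQ

theorem mk_smul_complex (a : ℂ) (ω : FreeForms N q) : mk N q s (a • ω) = a • mk N q s ω := rfl
theorem mk_smul (x : Sphere N q) (ω : FreeForms N q) : mk N q s (x • ω) = x • mk N q s ω := rfl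
theorem mk_op_smul (x : (Sphere N q)ᵐᵒᵖ) (ω : FreeForms N q) :
    mk N q s (x • ω) = x • mk N q s ω := rfl

theorem mk_eq_zero {z : FreeForms N q} (h : GammaRel N q s z) : mk N q s z = 0 :=
  (Submodule.Quotient.mk_eq_zero _).2 (Submodule.subset_span h)

theorem mk_leibniz (x y : Sphere N q) : mk N q s (FreeForms.symb (x * y)) =
    op y • mk N q s (FreeForms.symb x) + x • mk N q s (FreeForms.symb y) := by
  have h := mk_eq_zero (GammaRel.leibniz (s := s) x y)
  rw [map_sub, sub_eq_zero, map_add, mk_smul, mk_op_smul] at h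
  exact h

/-- The differential `d`, viewed as a linear map. -/
def dLin (N : ℕ) (q : ℝ) (s : ℤˣ) : Sphere N q →ₗ[ℂ] Gamma N q s where
  toFun x := mk N q s (FreeForms.symb x)
  map_add' x y := by
    have h := mk_eq_zero (GammaRel.add (s := s) x y)
    rwa [map_sub, sub_eq_zero, map_add] at h
  map_smul' a x := by
    have h := mk_eq_zero (GammaRel.smul (s := s) a x)
    rwa [map_sub, sub_eq_zero, mk_smul_complex] at h

theorem span_range_d :
    Submodule.span (Sphere N q) (Set.range (dLin N q s)) = ⊤ := by
  set S := Submodule.span (Sphere N q) (Set.range (dLin N q s)) with hS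
  have hop : ∀ (y : Sphere N q) (ω : Gamma N q s), ω ∈ S → op y • ω ∈ S := by
    intro y ω hω
    induction hω using Submodule.span_induction with
    | mem ω h =>
      obtain ⟨x, rfl⟩ := h
      have e : op y • dLin N q s x = dLin N q s (x * y) - x • dLin N q s y := by
        rw [eq_sub_iff_add_eq]
        exact (mk_leibniz x y).symm
      rw [e]
      exact S.sub_mem (Submodule.subset_span ⟨_, rfl⟩)
        (S.smul_mem _ (Submodule.subset_span ⟨_, rfl⟩))
    | zero => simp
    | add a b _ _ ha hb => rw [smul_add]; exact S.add_mem ha hb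
    | smul a b _ hb => rw [← smul_comm a (op y) b]; exact S.smul_mem _ hb
  have henv : ∀ (e : Env N q) (ω : Gamma N q s), ω ∈ S → e • ω ∈ S := by
    intro e ω hω
    induction e using TensorProduct.induction_on with
    | zero => exact (zero_smul (Env N q) ω).symm ▸ S.zero_mem
    | tmul x y =>
      have : (x ⊗ₜ[ℂ] y : Env N q) = envL N q x * envR N q y := by simp [envL, envR]
      rw [this, mul_smul]
      exact S.smul_mem x (hop y.unop ω hω)
    | add a b ha hb => rw [add_smul]; exact S.add_mem ha hb
  rw [eq_top_iff]
  rintro ω -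
  obtain ⟨z, rfl⟩ := (gammaRelations N q s).mkQ_surjective ω
  change mk N q s z ∈ S
  induction z using Finsupp.induction_linear with
  | zero => exact (map_zero (mk N q s)).symm ▸ S.zero_mem
  | add f g hf hg => exact (map_add (mk N q s) f g).symm ▸ S.add_mem hf hg
  | single x e =>
    have : (Finsupp.single x e : Sphere N q →₀ Env N q) =
        (e • FreeForms.symb x : FreeForms N q) := by
      change _ = e • (Finsupp.single x 1 : Sphere N q →₀ Env N q)
      simp
    rw [this]
    exact (map_smul (mk N q s) e _).symm ▸ henv e _ (Submodule.subset_span ⟨x, rfl⟩)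

end Gamma

/-- The first order differential calculus `Γ₊` (`s = 1`) or `Γ₋` (`s = -1`). -/
def gammaCalculus (N : ℕ) (q : ℝ) (s : ℤˣ) : FODC ℂ (Sphere N q) (Gamma N q s) where
  d := Gamma.dLin N q s
  leibniz := Gamma.mk_leibniz
  span_eq_top := Gamma.span_range_d

theorem gammaCalculus_bimodule (N : ℕ) (q : ℝ) (s : ℤˣ) :
    HasBimoduleStructure s (gammaCalculus N q s) := by
  intro i j
  have h := Gamma.mk_eq_zero (GammaRel.bimodule (q := q) (s := s) i j)
  rw [map_sub, sub_eq_zero, Gamma.mk_op_smul] at h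
  refine h.trans ?_
  simp only [bimoduleRHS, map_add, map_sum, Gamma.mk_smul_complex, Gamma.mk_smul]
  rfl

end QSphere

end

open QSphere

/-! Everything rests on commuting η past a generator. Multiplying (*) on the left by `C^{mi} x_m`
and summing turns `η x_j` into four terms. In the `R̂⁻` term the crossing identity `C^{mi}
(R̂⁻)^{kl}_{ij} = R̂^{mk}_{jp} C^{pl}` (`crossing`) brings the two sphere coordinates next to each
other. The sphere relations then reduce `R̂^{mk}_{jp} x_m x_k` to `q x_j x_p` plus a multiple of
`C_{jp}` (`sum_R_mul`), so this term is a combination of `x_j η` and `dx_j`. The other three terms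
collapse by `C^{kl} x_k x_l = 1` and `C² = 1`. The coefficients of `x_j η` add up to 1, which leaves
`η x_j - x_j η = λ dx_j` with `λ = (1 ∓ q)(1 ∓ q^{N-1}) / (± q (1 + q^{N-2}))` (`eta_mul_x`).

Since λ is nonzero and `η' = λ⁻¹ η`, the derivations `d` and `x ↦ η' x - x η'` agree on generators,
hence everywhere (`d_eq_commutator`). Invariance of η is the orthogonality relation `C^{kl} u^a_k
u^b_l = C^{ab}`.

For the presented calculus the covariance map must be constructed. It is prescribed on the free
bimodule of symbols and descends because every defining relation is equivariant: the Leibniz rule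
since the coaction is multiplicative, and (*) since `R̂⁻`, `K` and `C` intertwine the
corepresentation u (`coactionFreeForms_bimodule`). Coassociativity and counitality are then
inherited from the coaction on the sphere. -/

noncomputable section

namespace QSphere

/-! ### The metric `C` and its crossing relation with the R-matrix. -/

variable {N : ℕ}

theorem rho_rev (i : Fin N) : rho i.rev = -rho i := by
  have h := i.isLt
  have hc : ((i.rev : Fin N) : ℕ) = N - (i + 1) := Fin.val_rev i
  have hr : (((i.rev : Fin N) : ℕ) : ℝ) = N - (i + 1) := by
    rw [hc, Nat.cast_sub (by omega)]; push_cast; ring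
  unfold rho
  rw [hr]
  split_ifs <;> first | omega | skip
  · ring
  · ring
  · ring

theorem rpow_rho_rev {q : ℝ} (hq : 0 < q) (i : Fin N) : q ^ (-rho i.rev) = (q ^ (-rho i))⁻¹ := by
  rw [rho_rev, Real.rpow_neg hq.le]

/-- Because `ϱ_{i'} = -ϱ_i`, the two antidiagonal entries that meet in the product are inverse to
each other. -/
theorem sum_C_mul_C {q : ℝ} (hq : 0 < q) (i j : Fin N) :
    ∑ k, C q i k * C q k j = if i = j then 1 else 0 := by
  rw [Finset.sum_eq_single i.rev]
  · by_cases h : i = j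
    · subst h
      have := (Real.rpow_pos_of_pos hq (-rho i)).ne'
      simp [C, rpow_rho_rev hq, this]
    · simp [C, h]
  · intro k _ hk
    have : i ≠ k.rev := fun h => hk (by rw [h, Fin.rev_rev])
    simp [C, this]
  · simp

theorem eq_rev_comm {i j : Fin N} : i = j.rev ↔ j = i.rev :=
  ⟨fun h => by rw [h, Fin.rev_rev], fun h => by rw [h, Fin.rev_rev]⟩

/-- Rotating by the metric interchanges `I` and `K`. Passing from `R̂` to `R̂⁻` inverts the powers
of q at `i = l, j = k` and replaces `(i < l)(I - K)` by `-(i > l)(I - K)`; the rotation has the same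
effect. The proof compares entries according to which indices coincide. -/
theorem crossing_entry {q : ℝ} (hq : 0 < q) (m k l j : Fin N) :
    C q m m.rev * Rm q k l m.rev j = R q m k j l.rev * C q l.rev l := by
  have hq0 := hq.ne'
  have hm := (Real.rpow_pos_of_pos hq (-rho m)).ne'
  have hl := (Real.rpow_pos_of_pos hq (-rho l)).ne'
  have hk := (Real.rpow_pos_of_pos hq (-rho k)).ne'
  unfold Rm R K C
  -- The permutation term on either side requires `l = m'` and `j = k`.
  by_cases h1 : l = m.rev
  · subst h1
    by_cases h2 : j = k
    · subst h2
      by_cases h3 : m = j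
      · subst h3
        by_cases h4 : m = m.rev
        -- A self-dual index is the middle one, where the metric entry is 1.
        · have h0 : rho m = 0 := by
            have h5 := rho_rev m
            rw [← h4] at h5
            linarith
          simp [← h4, h0]
        · simp [h4, Ne.symm h4, rpow_rho_rev hq]
          field_simp
          ring
      · by_cases h4 : j = m.rev
        · subst h4
          simp [h3, Ne.symm h3, rpow_rho_rev hq, mul_comm]
        · have h5 : m ≠ j.rev := fun h => h4 (eq_rev_comm.1 h)
          simp [h3, Ne.symm h3, h4, Ne.symm h4, h5]
    · by_cases h3 : j = m.rev
      · subst h3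
        by_cases h4 : k = m
        · subst h4
          simp [h2, Ne.symm h2]
        · have h5 : m ≠ k.rev := fun h => h2 (eq_rev_comm.1 h).symm
          simp [h2, h4, Ne.symm h4, h5]
      · by_cases h4 : k = m
        · subst h4
          simp [h2, h3, Ne.symm h2]
        · simp [h2, h3, h4, Ne.symm h4]
  -- Only `I` and `K` remain: `j = l` is where `I` on the left meets `K` on the right, and `m = j`
  -- is where `K` on the left meets `I` on the right.
  · have h1' : m ≠ l.rev := fun h => h1 (eq_rev_comm.1 h)
    by_cases h2 : j = l
    · subst h2
      by_cases h3 : k = m.rev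
      · subst h3
        rcases lt_trichotomy j m.rev with h | h | h
        · by_cases h4 : m = j
          · subst h4
            simp [h, h.not_gt, Ne.symm h1, rpow_rho_rev hq]
            field_simp
            ring
          · simp [h, h.not_gt, Ne.symm h1, Ne.symm h1', h1, h4, Ne.symm h4, rpow_rho_rev hq]
            field_simp
            ring
        · exact absurd h h1
        · by_cases h4 : m = j
          · subst h4
            simp [h, h.not_gt, Ne.symm h1]
            right
            ring
          · simp [h, h.not_gt, Ne.symm h1, Ne.symm h1', h1, h4, Ne.symm h4]
      · have h3' : m ≠ k.rev := fun h => h3 (eq_rev_comm.1 h)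
        by_cases h4 : m = j
        · subst h4
          simp [h3, Ne.symm h3, h3', Ne.symm h1]
        · simp [Ne.symm h3, h3', Ne.symm h1, Ne.symm h1', h4, Ne.symm h4]
    · by_cases h3 : m = j
      · subst h3
        by_cases h4 : k = l.rev
        · subst h4
          have h5 : m.rev < l ↔ l.rev < m := by rw [← Fin.rev_lt_rev, Fin.rev_rev]
          rcases lt_trichotomy m l.rev with h | h | h
          · simp [h, h.not_gt, h5, h2, Ne.symm h1, Ne.symm h1', rpow_rho_rev hq]
            field_simp
          · exact absurd h h1'
          · simp [h, h.not_gt, h5, h2, Ne.symm h1, Ne.symm h1', rpow_rho_rev hq]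
        · simp [h2, h4, Ne.symm h4, Ne.symm h1, Ne.symm h1']
      · have h3' : ¬ m.rev = j.rev := fun h => h3 (Fin.rev_injective h)
        simp [Ne.symm h1, Ne.symm h1', h2, h3, Ne.symm h3]

theorem crossing {q : ℝ} (hq : 0 < q) (m k l j : Fin N) :
    ∑ i, C q m i * Rm q k l i j = ∑ p, R q m k j p * C q p l := by
  rw [Finset.sum_eq_single m.rev, Finset.sum_eq_single l.rev]
  · exact crossing_entry hq m k l j
  · intro p _ hp
    simp [C, hp]
  · simp
  · intro i _ hi
    have : m ≠ i.rev := fun h => hi (eq_rev_comm.1 h)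
    simp [C, this]
  · simp

/-- A derivation is determined by its values on algebra generators; this reduces the commutator
formula to the coordinates. -/
theorem Sphere.hom_ext_derivation {q : ℝ} {M : Type*} [AddCommGroup M] [Module ℂ M]
    [Module (Sphere N q) M] [Module (Sphere N q)ᵐᵒᵖ M]
    [SMulCommClass (Sphere N q) (Sphere N q)ᵐᵒᵖ M]
    {D E : Sphere N q →ₗ[ℂ] M}
    (hD : ∀ x y, D (x * y) = op y • D x + x • D y)
    (hE : ∀ x y, E (x * y) = op y • E x + x • E y)
    (h : ∀ i, D (Sphere.x q i) = E (Sphere.x q i)) : D = E := by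
  have one : ∀ F : Sphere N q →ₗ[ℂ] M, (∀ x y, F (x * y) = op y • F x + x • F y) → F 1 = 0 := by
    intro F hF
    -- The Leibniz rule at `1 * 1` reads `F 1 = F 1 + F 1`.
    simpa using hF 1 1
  refine LinearMap.ext fun z => ?_
  obtain ⟨w, rfl⟩ := RingQuot.mkAlgHom_surjective ℂ (SphereRel N q) z
  change D (Sphere.mk N q w) = E (Sphere.mk N q w)
  induction w using FreeAlgebra.induction with
  | grade0 r =>
    rw [AlgHom.commutes, Algebra.algebraMap_eq_smul_one, map_smul, map_smul, one D hD, one E hE]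
  | grade1 i => exact h i
  | mul a b ha hb => rw [map_mul, hD, hE, ha, hb]
  | add a b ha hb => rw [map_add, map_add, map_add, ha, hb]

/-! ### Commuting η past the coordinates. -/

section Inner

variable {q : ℝ} {M : Type*} [AddCommGroup M] [Module ℂ M] [Module (Sphere N q) M]
  [Module (Sphere N q)ᵐᵒᵖ M] [IsScalarTower ℂ (Sphere N q) M]
  [IsScalarTower ℂ (Sphere N q)ᵐᵒᵖ M] [SMulCommClass (Sphere N q) (Sphere N q)ᵐᵒᵖ M]

theorem sum_C_mul_C_complex (hq : 0 < q) (i j : Fin N) :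
    ∑ k, (C q i k : ℂ) * (C q k j : ℂ) = if i = j then 1 else 0 := by
  have h := congrArg (fun r : ℝ => (r : ℂ)) (sum_C_mul_C hq i j)
  simpa [apply_ite Complex.ofReal] using h

/-- Substitute `R̂ = R̂⁻ + (q - q⁻¹) I - (q - q⁻¹) K` and apply the sphere relations: `q⁻¹ + (q -
q⁻¹) = q`, and `K` contributes `C_{jp}`. -/
theorem sum_R_mul (q : ℝ) (j p : Fin N) :
    ∑ m, ∑ k, (R q m k j p : ℂ) • (Sphere.x q m * Sphere.x q k) =
      (q : ℂ) • (Sphere.x q j * Sphere.x q p) +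
        ((((q ^ (N - 1) - q ^ (N - 3)) / (1 + q ^ (N - 2)) - (q - q⁻¹)) * C q j p : ℝ) : ℂ) •
          (1 : Sphere N q) := by
  have e : ∀ m k : Fin N, (R q m k j p : ℂ) = (Rm q m k j p : ℂ) +
      ((q - q⁻¹ : ℝ) : ℂ) * ((if m = j then 1 else 0) * (if k = p then 1 else 0)) -
      ((q - q⁻¹ : ℝ) : ℂ) * (K q m k j p : ℂ) := by
    intro m k
    simp only [Rm, eq_comm (a := m), eq_comm (a := k)]
    push_cast
    split_ifs <;> simp only [Complex.ofReal_one, Complex.ofReal_zero] <;> ring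
  have hK : ∑ m, ∑ k, (K q m k j p : ℂ) • (Sphere.x q m * Sphere.x q k) =
      (C q j p : ℂ) • (1 : Sphere N q) := by
    simp only [K, Complex.ofReal_mul, mul_smul, ← Finset.smul_sum, sphere_unit]
  have hI : ∑ m, ∑ k, ((if m = j then 1 else 0) * (if k = p then 1 else 0) : ℂ) •
      (Sphere.x q m * Sphere.x q k) = Sphere.x q j * Sphere.x q p := by
    simp
  simp only [e, sub_smul, add_smul, mul_smul ((q - q⁻¹ : ℝ) : ℂ), Finset.sum_add_distrib,
    Finset.sum_sub_distrib, ← Finset.smul_sum, hI, hK, sphere_comm]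
  push_cast
  module

omit [IsScalarTower ℂ (Sphere N q)ᵐᵒᵖ M] [SMulCommClass (Sphere N q) (Sphere N q)ᵐᵒᵖ M] in
theorem bimoduleRHS_eq (s : ℤˣ) (c : FODC ℂ (Sphere N q) M) (i j : Fin N) :
    bimoduleRHS s c.d i j =
      (sgn s : ℂ) • ∑ k, ∑ l, (Rm q k l i j : ℂ) • (Sphere.x q k • c.d (Sphere.x q l))
      + ((sgn s * q - 1 : ℝ) : ℂ) • (Sphere.x q i • c.d (Sphere.x q j))
      + (((q ^ N - q ^ (N - 2)) / (1 - sgn s * q ^ (N - 1)) : ℝ) : ℂ) • (C q i j : ℂ) • eta c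
      + (((1 - sgn s * q) * (1 + q ^ (N - 2)) / (1 - sgn s * q ^ (N - 1)) : ℝ) : ℂ) •
        (Sphere.x q i * Sphere.x q j) • eta c := by
  simp only [bimoduleRHS, eta, K, Complex.ofReal_mul, mul_smul, Finset.smul_sum,
    smul_comm (Sphere.x q _) (_ : ℂ)]

-- This is the `R̂⁻` contribution to `η x_j`. Crossing makes the R-matrix act on the two
-- coordinates, where `sum_R_mul` evaluates it.
omit [IsScalarTower ℂ (Sphere N q)ᵐᵒᵖ M] [SMulCommClass (Sphere N q) (Sphere N q)ᵐᵒᵖ M] in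
theorem sum_C_crossing (hq : 0 < q) (c : FODC ℂ (Sphere N q) M) (j : Fin N) :
    ∑ m, ∑ i, (C q m i : ℂ) • (Sphere.x q m •
        ∑ k, ∑ l, (Rm q k l i j : ℂ) • (Sphere.x q k • c.d (Sphere.x q l))) =
      (q : ℂ) • (Sphere.x q j • eta c) +
        (((q ^ (N - 1) - q ^ (N - 3)) / (1 + q ^ (N - 2)) - (q - q⁻¹) : ℝ) : ℂ) •
          c.d (Sphere.x q j) := by
  have h1 : ∀ m k l : Fin N, (∑ i, (C q m i : ℂ) * (Rm q k l i j : ℂ)) =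
      ∑ p, (R q m k j p : ℂ) * (C q p l : ℂ) := fun m k l => by
    exact_mod_cast crossing hq m k l j
  have h2 : ∀ l : Fin N, (∑ p, (C q j p : ℂ) * (C q p l : ℂ)) = if j = l then 1 else 0 :=
    sum_C_mul_C_complex hq j
  calc _ = ∑ m, ∑ k, ∑ l, (∑ i, (C q m i : ℂ) * (Rm q k l i j : ℂ)) •
        ((Sphere.x q m * Sphere.x q k) • c.d (Sphere.x q l)) := by
        simp only [Finset.smul_sum, Finset.sum_smul, smul_comm (Sphere.x q _) (_ : ℂ), mul_smul]
        refine Finset.sum_congr rfl fun m _ => ?_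
        rw [Finset.sum_comm]
        refine Finset.sum_congr rfl fun k _ => ?_
        rw [Finset.sum_comm]
    _ = ∑ l, ∑ p, (C q p l : ℂ) • ((∑ m, ∑ k, (R q m k j p : ℂ) •
          (Sphere.x q m * Sphere.x q k)) • c.d (Sphere.x q l)) := by
        simp only [h1, Finset.smul_sum, Finset.sum_smul, smul_assoc, mul_smul]
        have h := Oq.sum_smul_comm (fun _ _ : Fin N => (1 : ℂ)) fun m k l p =>
          (R q m k j p : ℂ) • (C q p l : ℂ) • Sphere.x q m • Sphere.x q k • c.d (Sphere.x q l)
        simp only [one_smul] at h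
        rw [h]
        simp only [smul_comm (R q _ _ _ _ : ℂ)]
    _ = _ := by
        -- The part `q x_j x_p` reassembles η; in the part with `C_{jp}` the two metrics cancel and
        -- leave `dx_j`.
        simp only [sum_R_mul, add_smul, smul_add, Finset.sum_add_distrib]
        congr 1
        · rw [Finset.sum_comm]
          simp only [eta, Finset.smul_sum, smul_comm (Sphere.x q _) (_ : ℂ), smul_assoc, mul_smul,
            smul_comm (C q _ _ : ℂ) (q : ℂ)]
        · have h3 : ∀ (g : ℝ) (l : Fin N), ∑ p, (C q p l : ℂ) •
              (((g * C q j p : ℝ) : ℂ) • (1 : Sphere N q)) • c.d (Sphere.x q l) =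
              (g : ℂ) • (if j = l then (1 : ℂ) else 0) • c.d (Sphere.x q l) := by
            intro g l
            rw [← h2, Finset.sum_smul, Finset.smul_sum]
            refine Finset.sum_congr rfl fun p _ => ?_
            rw [smul_assoc, one_smul, Complex.ofReal_mul]
            module
          simp only [h3, ← Finset.smul_sum]
          simp

/-- For the upper sign a positive `q ≠ 1` is not a root of unity; for the lower sign the expression
is a sum of positive numbers. -/
theorem one_sub_sgn_mul_pow_ne_zero (hq : 0 < q) (hq1 : q ≠ 1) (s : ℤˣ) {n : ℕ} (hn : n ≠ 0) :
    1 - sgn s * q ^ n ≠ 0 := by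
  rcases Int.units_eq_one_or s with rfl | rfl
  · have := mt (pow_eq_one_iff_of_nonneg hq.le hn).1 hq1
    simpa [sgn, sub_eq_zero, eq_comm (a := (1 : ℝ))] using this
  · have : 0 < 1 + q ^ n := by positivity
    simpa [sgn] using this.ne'

/-- The coefficient of `dx_j` is exactly the inverse of the factor that turns η into η'. -/
theorem eta_mul_x (hN : 3 ≤ N) (hq : 0 < q) (hq1 : q ≠ 1) {s : ℤˣ} {c : FODC ℂ (Sphere N q) M}
    (hc : HasBimoduleStructure s c) (j : Fin N) :
    op (Sphere.x q j) • eta c = Sphere.x q j • eta c +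
      (((1 - sgn s * q) * (1 - sgn s * q ^ (N - 1)) / (sgn s * q * (1 + q ^ (N - 2))) : ℝ) : ℂ) •
        c.d (Sphere.x q j) := by
  have h2 : ∀ m : Fin N, (∑ i, (C q m i : ℂ) * (C q i j : ℂ)) = if m = j then 1 else 0 :=
    fun m => sum_C_mul_C_complex hq m j
  have t1 := sum_C_crossing hq c j
  have t2 : ∑ m : Fin N, ∑ i : Fin N, (C q m i : ℂ) •
      (Sphere.x q m • Sphere.x q i • c.d (Sphere.x q j)) =
      c.d (Sphere.x q j) := by
    have := congrArg (· • c.d (Sphere.x q j)) (sphere_unit (N := N) q)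
    simpa only [Finset.sum_smul, smul_assoc, mul_smul, one_smul] using this
  have t3 : ∑ m : Fin N, ∑ i : Fin N, (C q m i : ℂ) • (Sphere.x q m • (C q i j : ℂ) • eta c) =
      Sphere.x q j • eta c := by
    simp only [smul_comm (Sphere.x q _) (_ : ℂ), smul_smul, ← Finset.sum_smul, h2]
    simp
  have t4 : ∑ m : Fin N, ∑ i : Fin N, (C q m i : ℂ) •
      (Sphere.x q m • (Sphere.x q i * Sphere.x q j) • eta c) =
      Sphere.x q j • eta c := by
    have := congrArg (fun z => z • Sphere.x q j • eta c) (sphere_unit (N := N) q)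
    simpa only [Finset.sum_smul, smul_assoc, mul_smul, one_smul] using this
  have key : op (Sphere.x q j) • eta c =
      (sgn s : ℂ) • ((q : ℂ) • (Sphere.x q j • eta c) +
        (((q ^ (N - 1) - q ^ (N - 3)) / (1 + q ^ (N - 2)) - (q - q⁻¹) : ℝ) : ℂ) •
          c.d (Sphere.x q j))
      + ((sgn s * q - 1 : ℝ) : ℂ) • c.d (Sphere.x q j)
      + (((q ^ N - q ^ (N - 2)) / (1 - sgn s * q ^ (N - 1)) : ℝ) : ℂ) • Sphere.x q j • eta c
      + (((1 - sgn s * q) * (1 + q ^ (N - 2)) / (1 - sgn s * q ^ (N - 1)) : ℝ) : ℂ) •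
        Sphere.x q j • eta c := by
    have h0 : op (Sphere.x q j) • eta c =
        ∑ m, ∑ i, (C q m i : ℂ) • (Sphere.x q m • bimoduleRHS s c.d i j) := by
      rw [eta]
      simp only [Finset.smul_sum, smul_comm (op (Sphere.x q _)) (_ : ℂ),
        ← smul_comm (Sphere.x q _) (op (Sphere.x q _)), hc _ j]
    rw [h0]
    have hpull : ∀ (a : ℂ) (f : Fin N → M), ∑ m, ∑ i, (C q m i : ℂ) • (Sphere.x q m • a • f i) =
        a • ∑ m, ∑ i, (C q m i : ℂ) • (Sphere.x q m • f i) := by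
      intro a f
      simp only [Finset.smul_sum, smul_comm (Sphere.x q _) a, smul_comm (C q _ _ : ℂ) a]
    simp only [bimoduleRHS_eq, smul_add, Finset.sum_add_distrib]
    rw [hpull, hpull, hpull, hpull, t1, t2, t3, t4, smul_add]
  rw [key]
  -- The truncated exponents `N - 1`, `N - 2`, `N - 3` become `n + 2`, `n + 1`, `n`.
  obtain ⟨n, rfl⟩ : ∃ n, N = n + 3 := ⟨N - 3, by omega⟩
  have hs : sgn s = 1 ∨ sgn s = -1 := by
    rcases Int.units_eq_one_or s with rfl | rfl <;> simp [sgn]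
  have hden := one_sub_sgn_mul_pow_ne_zero hq hq1 s (n := n + 2) (by omega)
  have hP : 1 + q ^ (n + 1) ≠ 0 := by positivity
  have hss : sgn s * sgn s = 1 := by rcases hs with h | h <;> simp [h]
  have hs0 : sgn s ≠ 0 := by rcases hs with h | h <;> simp [h]
  -- `kA` is the total coefficient of `x_j η` and `kB` that of `dx_j`; after clearing denominators
  -- both need only `s² = 1`.
  have kA : sgn s * q + (q ^ (n + 3) - q ^ (n + 1)) / (1 - sgn s * q ^ (n + 2)) +
      (1 - sgn s * q) * (1 + q ^ (n + 1)) / (1 - sgn s * q ^ (n + 2)) = 1 := by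
    field_simp
    linear_combination (- q ^ (n + 3)) * hss
  have kB : sgn s * ((q ^ (n + 2) - q ^ n) / (1 + q ^ (n + 1)) - (q - q⁻¹)) + (sgn s * q - 1) =
      (1 - sgn s * q) * (1 - sgn s * q ^ (n + 2)) / (sgn s * q * (1 + q ^ (n + 1))) := by
    field_simp
    simp only [pow_succ]
    linear_combination hss
  simp only [Nat.add_sub_cancel, show n + 3 - 1 = n + 2 from rfl, show n + 3 - 2 = n + 1 from rfl]
  rw [← kB]
  generalize ((q ^ (n + 2) - q ^ n) / (1 + q ^ (n + 1)) - (q - q⁻¹) : ℝ) = g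
  generalize (q ^ (n + 3) - q ^ (n + 1)) / (1 - sgn s * q ^ (n + 2)) = a at kA ⊢
  generalize (1 - sgn s * q) * (1 + q ^ (n + 1)) / (1 - sgn s * q ^ (n + 2)) = b at kA ⊢
  generalize Sphere.x q j • eta c = A
  generalize c.d (Sphere.x q j) = B
  have kA' := congrArg (fun r : ℝ => (r : ℂ) • A) kA
  simp only [Complex.ofReal_add, Complex.ofReal_mul, Complex.ofReal_one, one_smul] at kA' ⊢
  linear_combination (norm := module) kA'

theorem d_eq_commutator (hN : 3 ≤ N) (hq : 0 < q) (hq1 : q ≠ 1) {s : ℤˣ}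
    {c : FODC ℂ (Sphere N q) M} (hc : HasBimoduleStructure s c) (x : Sphere N q) :
    c.d x = op x • eta' s c - x • eta' s c := by
  let ad : Sphere N q →ₗ[ℂ] M :=
    { toFun := fun x => op x • eta' s c - x • eta' s c
      map_add' := fun x y => by rw [MulOpposite.op_add, add_smul, add_smul]; abel
      map_smul' := fun a x => by
        rw [MulOpposite.op_smul, smul_assoc, smul_assoc, RingHom.id_apply, smul_sub] }
  suffices h : c.d = ad from LinearMap.congr_fun h x
  refine Sphere.hom_ext_derivation c.leibniz (fun x y => ?_) fun j => ?_
  -- The commutator with any fixed form is a derivation: the mixed terms `x η' y` cancel.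
  · change op (x * y) • eta' s c - (x * y) • eta' s c =
      op y • (op x • eta' s c - x • eta' s c) + x • (op y • eta' s c - y • eta' s c)
    rw [MulOpposite.op_mul, mul_smul, mul_smul, smul_sub, smul_sub, smul_comm x (op y)]
    abel
  · change _ = op (Sphere.x q j) • eta' s c - Sphere.x q j • eta' s c
    have hP : 1 + q ^ (N - 2) ≠ 0 := by positivity
    have hs0 : sgn s ≠ 0 := by rcases Int.units_eq_one_or s with rfl | rfl <;> simp [sgn]
    have h1 := one_sub_sgn_mul_pow_ne_zero hq hq1 s (n := 1) one_ne_zero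
    have h2 := one_sub_sgn_mul_pow_ne_zero hq hq1 s (n := N - 1) (by omega)
    rw [pow_one] at h1
    rw [eta', smul_comm (op _) (_ : ℂ), smul_comm (Sphere.x q j) (_ : ℂ), ← smul_sub,
      eta_mul_x hN hq hq1 hc, add_sub_cancel_left, smul_smul, ← Complex.ofReal_mul]
    have h3 : sgn s * q * (1 + q ^ (N - 2)) / ((1 - sgn s * q) * (1 - sgn s * q ^ (N - 1))) *
        ((1 - sgn s * q) * (1 - sgn s * q ^ (N - 1)) / (sgn s * q * (1 + q ^ (N - 2)))) = 1 := by
      field_simp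
    rw [h3, Complex.ofReal_one, one_smul]

end Inner

/-! ### `Γ ⊗ A` as a bimodule over `X ⊗ A`. -/

section Invariance

variable {k X Γ A : Type*} [Field k] [Ring X] [Algebra k X] [AddCommGroup Γ] [Module k Γ]
  [Module X Γ] [Module Xᵐᵒᵖ Γ] [IsScalarTower k X Γ] [IsScalarTower k Xᵐᵒᵖ Γ]
  [SMulCommClass X Xᵐᵒᵖ Γ] [Ring A] [Algebra k A]

omit [Module Xᵐᵒᵖ Γ] [IsScalarTower k Xᵐᵒᵖ Γ] [SMulCommClass X Xᵐᵒᵖ Γ] in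
@[simp] theorem leftMul_tmul (x : X) (a : A) (ω : Γ) (b : A) :
    leftMul k X Γ A (x ⊗ₜ a) (ω ⊗ₜ b) = (x • ω) ⊗ₜ (a * b) := by
  simp [leftMul]

omit [Module X Γ] [IsScalarTower k X Γ] [SMulCommClass X Xᵐᵒᵖ Γ] in
@[simp] theorem rightMul_tmul (x : X) (a : A) (ω : Γ) (b : A) :
    rightMul k X Γ A (x ⊗ₜ a) (ω ⊗ₜ b) = (op x • ω) ⊗ₜ (b * a) := by
  simp [rightMul]

omit [Module Xᵐᵒᵖ Γ] [IsScalarTower k Xᵐᵒᵖ Γ] [SMulCommClass X Xᵐᵒᵖ Γ] in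
theorem leftMul_mul (z w : X ⊗[k] A) :
    leftMul k X Γ A (z * w) = leftMul k X Γ A z ∘ₗ leftMul k X Γ A w := by
  induction z with
  | zero => simp
  | add a b ha hb => rw [add_mul, map_add, map_add, ha, hb, LinearMap.add_comp]
  | tmul x a =>
    induction w with
    | zero => simp
    | add c d hc hd => rw [mul_add, map_add, map_add, hc, hd, LinearMap.comp_add]
    | tmul y b => ext; simp [mul_smul, mul_assoc]

omit [Module X Γ] [IsScalarTower k X Γ] [SMulCommClass X Xᵐᵒᵖ Γ] in
theorem rightMul_mul (z w : X ⊗[k] A) :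
    rightMul k X Γ A (z * w) = rightMul k X Γ A w ∘ₗ rightMul k X Γ A z := by
  induction z with
  | zero => simp
  | add a b ha hb => rw [add_mul, map_add, map_add, ha, hb, LinearMap.comp_add]
  | tmul x a =>
    induction w with
    | zero => simp
    | add c d hc hd => rw [mul_add, map_add, map_add, hc, hd, LinearMap.add_comp]
    | tmul y b => ext; simp [mul_smul, mul_assoc]

omit [Module Xᵐᵒᵖ Γ] [IsScalarTower k Xᵐᵒᵖ Γ] [SMulCommClass X Xᵐᵒᵖ Γ] in
theorem leftMul_one : leftMul k X Γ A 1 = LinearMap.id := by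
  ext; simp [Algebra.TensorProduct.one_def]

omit [Module X Γ] [IsScalarTower k X Γ] [SMulCommClass X Xᵐᵒᵖ Γ] in
theorem rightMul_one : rightMul k X Γ A 1 = LinearMap.id := by
  ext; simp [Algebra.TensorProduct.one_def]

theorem leftMul_rightMul_comm (z w : X ⊗[k] A) :
    leftMul k X Γ A z ∘ₗ rightMul k X Γ A w = rightMul k X Γ A w ∘ₗ leftMul k X Γ A z := by
  induction z with
  | zero => simp
  | add a b ha hb => rw [map_add, LinearMap.add_comp, LinearMap.comp_add, ha, hb]
  | tmul x a =>
    induction w with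
    | zero => simp
    | add c d hc hd => rw [map_add, LinearMap.add_comp, LinearMap.comp_add, hc, hd]
    | tmul y b => ext; simp [mul_assoc, smul_comm x (op y)]

-- With this Leibniz rule for `d ⊗ id`, multiplicativity of the coaction makes the prescribed values
-- on symbols respect the Leibniz relation.
omit [SMulCommClass X Xᵐᵒᵖ Γ] in
theorem FODC.rTensor_mul (c : FODC k X Γ) (z w : X ⊗[k] A) :
    c.d.rTensor A (z * w) =
      rightMul k X Γ A w (c.d.rTensor A z) + leftMul k X Γ A z (c.d.rTensor A w) := by
  induction z with
  | zero => simp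
  | add a b ha hb => simp only [add_mul, map_add, LinearMap.add_apply, ha, hb]; abel
  | tmul x a =>
    induction w with
    | zero => simp
    | add c d hc hd => simp only [mul_add, map_add, LinearMap.add_apply, hc, hd]; abel
    | tmul y b => simp [c.leibniz, TensorProduct.add_tmul]

end Invariance

/-! ### Coassociativity and counit on forms, deduced from those on `X`. -/

section Covariance

variable {k X Γ A : Type*} [Field k] [Ring X] [Algebra k X] [AddCommGroup Γ] [Module k Γ]
  [Module X Γ] [Module Xᵐᵒᵖ Γ] [IsScalarTower k X Γ] [IsScalarTower k Xᵐᵒᵖ Γ]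
  [SMulCommClass X Xᵐᵒᵖ Γ] [Ring A] [Bialgebra k A]

omit [IsScalarTower k X Γ] [IsScalarTower k Xᵐᵒᵖ Γ] [SMulCommClass X Xᵐᵒᵖ Γ] in
theorem FODC.hom_ext (c : FODC k X Γ) {V : Type*} [AddCommGroup V] [Module k V]
    {F G : Γ →ₗ[k] V} (h : ∀ x y : X, F (x • c.d y) = G (x • c.d y)) : F = G := by
  refine LinearMap.ext fun ω => ?_
  have hω : ω ∈ Submodule.span X (Set.range c.d) := by rw [c.span_eq_top]; trivial
  rw [Submodule.mem_span_set'] at hω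
  obtain ⟨n, f, g, rfl⟩ := hω
  rw [map_sum, map_sum]
  refine Finset.sum_congr rfl fun i _ => ?_
  obtain ⟨y, hy⟩ := (g i).2
  rw [← hy, h]

omit [IsScalarTower k Xᵐᵒᵖ Γ] [SMulCommClass X Xᵐᵒᵖ Γ] in
theorem FODC.rTensor_assoc_leftMul (c : FODC k X Γ) (ζ ξ : X ⊗[k] A) (a b : A) :
    TensorProduct.assoc k Γ A A (leftMul k X Γ A ζ (c.d.rTensor A ξ) ⊗ₜ (a * b)) =
      leftMul k X Γ (A ⊗[k] A) (TensorProduct.assoc k X A A (ζ ⊗ₜ a))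
        (c.d.rTensor (A ⊗[k] A) (TensorProduct.assoc k X A A (ξ ⊗ₜ b))) := by
  induction ζ with
  | zero => simp
  | add z w hz hw => simp only [map_add, LinearMap.add_apply, TensorProduct.add_tmul, hz, hw]
  | tmul x a' =>
    induction ξ with
    | zero => simp
    | add z w hz hw => simp only [map_add, TensorProduct.add_tmul, hz, hw]
    | tmul y b' => simp

omit [SMulCommClass X Xᵐᵒᵖ Γ] in
/-- A bimodule map along the coaction that is compatible with `d` is automatically coassociative
and counital. -/
theorem FODC.isCovarianceMap_of_map_smul (c : FODC k X Γ) {δ : X →ₐ[k] X ⊗[k] A}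
    (hcoassoc : ∀ x, TensorProduct.assoc k X A A (δ.toLinearMap.rTensor A (δ x)) =
      (Coalgebra.comul : A →ₗ[k] A ⊗[k] A).lTensor X (δ x))
    (hcounit : ∀ x, TensorProduct.rid k X
      ((Coalgebra.counit : A →ₗ[k] k).lTensor X (δ x)) = x)
    {Φ : Γ →ₗ[k] Γ ⊗[k] A} (hd : ∀ x : X, Φ (c.d x) = c.d.rTensor A (δ x))
    (hΦ : ∀ (x y : X) (ω : Γ),
      Φ (x • op y • ω) = leftMul k X Γ A (δ x) (rightMul k X Γ A (δ y) (Φ ω))) :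
    c.IsCovarianceMap δ Φ := by
  have hl : ∀ x y : X, Φ (x • c.d y) = leftMul k X Γ A (δ x) (c.d.rTensor A (δ y)) := by
    intro x y
    simpa [rightMul_one, hd] using hΦ x 1 (c.d y)
  -- On `x dy` each side of coassociativity splits into a factor depending on `δ x` and one
  -- depending on `δ y`. Hence `h1` and `h2` reduce it to coassociativity of δ, and `h3` does the
  -- same for the counit.
  have h1 : ∀ z w : X ⊗[k] A,
      TensorProduct.assoc k Γ A A (Φ.rTensor A (leftMul k X Γ A z (c.d.rTensor A w))) =
      leftMul k X Γ (A ⊗[k] A) (TensorProduct.assoc k X A A (δ.toLinearMap.rTensor A z))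
        (c.d.rTensor (A ⊗[k] A) (TensorProduct.assoc k X A A (δ.toLinearMap.rTensor A w))) := by
    intro z w
    induction z with
    | zero => simp
    | add a b ha hb => simp only [map_add, LinearMap.add_apply, ha, hb]
    | tmul x a =>
      induction w with
      | zero => simp
      | add a b ha hb => simp only [map_add, ha, hb]
      | tmul y b =>
        simp only [LinearMap.rTensor_tmul, leftMul_tmul, hl, c.rTensor_assoc_leftMul]
        rfl
  have h2 : ∀ z w : X ⊗[k] A,
      (Coalgebra.comul : A →ₗ[k] A ⊗[k] A).lTensor Γ (leftMul k X Γ A z (c.d.rTensor A w)) =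
      leftMul k X Γ (A ⊗[k] A) ((Coalgebra.comul : A →ₗ[k] A ⊗[k] A).lTensor X z)
        (c.d.rTensor (A ⊗[k] A) ((Coalgebra.comul : A →ₗ[k] A ⊗[k] A).lTensor X w)) := by
    intro z w
    induction z with
    | zero => simp
    | add a b ha hb => simp only [map_add, LinearMap.add_apply, ha, hb]
    | tmul x a =>
      induction w with
      | zero => simp
      | add a b ha hb => simp only [map_add, ha, hb]
      | tmul y b => simp
  have h3 : ∀ z w : X ⊗[k] A,
      TensorProduct.rid k Γ ((Coalgebra.counit : A →ₗ[k] k).lTensor Γ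
        (leftMul k X Γ A z (c.d.rTensor A w))) =
      TensorProduct.rid k X ((Coalgebra.counit : A →ₗ[k] k).lTensor X z) •
        c.d (TensorProduct.rid k X ((Coalgebra.counit : A →ₗ[k] k).lTensor X w)) := by
    intro z w
    induction z with
    | zero => simp
    | add a b ha hb => simp only [map_add, LinearMap.add_apply, add_smul, ha, hb]
    | tmul x a =>
      induction w with
      | zero => simp
      | add a b ha hb => simp only [map_add, smul_add, ha, hb]
      | tmul y b =>
        simp [smul_smul, smul_comm x (_ : k)]
  refine ⟨hd, hΦ, fun ω => ?_, fun ω => ?_⟩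
  · have : (TensorProduct.assoc k Γ A A).toLinearMap ∘ₗ Φ.rTensor A ∘ₗ Φ =
        (Coalgebra.comul : A →ₗ[k] A ⊗[k] A).lTensor Γ ∘ₗ Φ :=
      c.hom_ext fun x y => by simp [hl, h1, h2, hcoassoc]
    exact LinearMap.congr_fun this ω
  · have : (TensorProduct.rid k Γ).toLinearMap ∘ₗ
        (Coalgebra.counit : A →ₗ[k] k).lTensor Γ ∘ₗ Φ = LinearMap.id :=
      c.hom_ext fun x y => by simp [hl, h3, hcounit]
    exact LinearMap.congr_fun this ω

end Covariance

/-! ### The coaction on the sphere is coassociative and counital. -/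

variable {q : ℝ}

theorem Sphere.hom_ext {B : Type*} [Ring B] [Algebra ℂ B] {f g : Sphere N q →ₐ[ℂ] B}
    (h : ∀ i, f (Sphere.x q i) = g (Sphere.x q i)) : f = g :=
  RingQuot.ringQuot_ext' ℂ _ _ (FreeAlgebra.hom_ext (funext h))

theorem coaction_coassoc (x : Sphere N q) :
    TensorProduct.assoc ℂ (Sphere N q) (Oq N q) (Oq N q)
      ((coaction N q).toLinearMap.rTensor (Oq N q) (coaction N q x)) =
      (Coalgebra.comul : Oq N q →ₗ[ℂ] Oq N q ⊗[ℂ] Oq N q).lTensor (Sphere N q)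
        (coaction N q x) := by
  have h : (Algebra.TensorProduct.assoc ℂ ℂ ℂ (Sphere N q) (Oq N q) (Oq N q)).toAlgHom.comp
      ((Algebra.TensorProduct.map (coaction N q) (AlgHom.id ℂ (Oq N q))).comp (coaction N q)) =
      (Algebra.TensorProduct.map (AlgHom.id ℂ (Sphere N q)) (Oq.comulHom N q)).comp
        (coaction N q) := by
    refine Sphere.hom_ext fun i => ?_
    simp only [AlgHom.comp_apply, coaction_x, map_sum, Algebra.TensorProduct.map_tmul,
      Oq.comulHom_u, TensorProduct.sum_tmul, TensorProduct.tmul_sum, AlgHom.id_apply]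
    rw [Finset.sum_comm]
    rfl
  exact AlgHom.congr_fun h x

theorem coaction_counit (x : Sphere N q) :
    TensorProduct.rid ℂ (Sphere N q)
      ((Coalgebra.counit : Oq N q →ₗ[ℂ] ℂ).lTensor (Sphere N q) (coaction N q x)) = x := by
  have h : (Algebra.TensorProduct.rid ℂ ℂ (Sphere N q)).toAlgHom.comp
      ((Algebra.TensorProduct.map (AlgHom.id ℂ (Sphere N q)) (Oq.counitHom N q)).comp
        (coaction N q)) = AlgHom.id ℂ (Sphere N q) := by
    refine Sphere.hom_ext fun i => ?_
    simp [coaction_x, Oq.counitHom_u]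
  exact AlgHom.congr_fun h x

/-! ### Invariance of η and η'. -/

section Invariant

variable {M : Type*} [AddCommGroup M] [Module ℂ M] [Module (Sphere N q) M]
  [Module (Sphere N q)ᵐᵒᵖ M] [IsScalarTower ℂ (Sphere N q) M]
  [IsScalarTower ℂ (Sphere N q)ᵐᵒᵖ M] [SMulCommClass (Sphere N q) (Sphere N q)ᵐᵒᵖ M]

omit [IsScalarTower ℂ (Sphere N q)ᵐᵒᵖ M] [SMulCommClass (Sphere N q) (Sphere N q)ᵐᵒᵖ M] in
theorem leftMul_coaction_d (c : FODC ℂ (Sphere N q) M) (i j : Fin N) :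
    leftMul ℂ (Sphere N q) M (Oq N q) (coaction N q (Sphere.x q i))
      (c.d.rTensor (Oq N q) (coaction N q (Sphere.x q j))) =
      ∑ a, ∑ b, (Sphere.x q a • c.d (Sphere.x q b)) ⊗ₜ[ℂ] (Oq.u q a i * Oq.u q b j) := by
  rw [Finset.sum_comm]
  simp [coaction_x, LinearMap.sum_apply]

-- Orthogonality moves the contraction from the `u` factors to the forms. No covariance map appears,
-- so the formula is also available while that map is being constructed.
omit [IsScalarTower ℂ (Sphere N q)ᵐᵒᵖ M] [SMulCommClass (Sphere N q) (Sphere N q)ᵐᵒᵖ M] in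
theorem sum_C_leftMul_coaction_d (c : FODC ℂ (Sphere N q) M) :
    ∑ k, ∑ l, (C q k l : ℂ) • leftMul ℂ (Sphere N q) M (Oq N q) (coaction N q (Sphere.x q k))
      (c.d.rTensor (Oq N q) (coaction N q (Sphere.x q l))) = eta c ⊗ₜ[ℂ] 1 := by
  simp only [leftMul_coaction_d]
  rw [Oq.sum_smul_comm]
  simp only [← TensorProduct.tmul_smul, ← TensorProduct.tmul_sum, Oq.orth]
  simp only [Algebra.algebraMap_eq_smul_one, TensorProduct.tmul_smul,
    TensorProduct.smul_tmul', ← TensorProduct.sum_tmul]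
  rfl

omit [SMulCommClass (Sphere N q) (Sphere N q)ᵐᵒᵖ M] in
theorem isInvariant_eta {c : FODC ℂ (Sphere N q) M} {Φ : M →ₗ[ℂ] M ⊗[ℂ] Oq N q}
    (h : c.IsCovarianceMap (coaction N q) Φ) : IsInvariant Φ (eta c) := by
  have hl : ∀ x y, Φ (x • c.d y) = leftMul ℂ (Sphere N q) M (Oq N q) (coaction N q x)
      (c.d.rTensor (Oq N q) (coaction N q y)) := by
    intro x y
    simpa [rightMul_one, h.map_d] using h.map_smul x 1 (c.d y)
  rw [IsInvariant, ← sum_C_leftMul_coaction_d]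
  simp only [eta, map_sum, map_smul, hl]

omit [SMulCommClass (Sphere N q) (Sphere N q)ᵐᵒᵖ M] in
theorem isInvariant_eta' {c : FODC ℂ (Sphere N q) M} {Φ : M →ₗ[ℂ] M ⊗[ℂ] Oq N q} (s : ℤˣ)
    (h : c.IsCovarianceMap (coaction N q) Φ) : IsInvariant Φ (eta' s c) := by
  rw [IsInvariant, eta', map_smul, isInvariant_eta h, TensorProduct.smul_tmul']

end Invariant

/-! ### Covariance of the calculus given by generators and relations. -/

namespace Gamma

variable {s : ℤˣ}

/-- The action of the enveloping algebra on `Γ ⊗ O_q(N)` through the coaction. -/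
def envAction (N : ℕ) (q : ℝ) (s : ℤˣ) :
    Env N q →ₐ[ℂ] Module.End ℂ (Gamma N q s ⊗[ℂ] Oq N q) :=
  Algebra.TensorProduct.lift
    (AlgHom.ofLinearMap
      (leftMul ℂ (Sphere N q) (Gamma N q s) (Oq N q) ∘ₗ (coaction N q).toLinearMap)
      (by
        change leftMul _ _ _ _ (coaction N q 1) = _
        rw [map_one]
        exact leftMul_one)
      (fun x y => by
        change leftMul _ _ _ _ (coaction N q (x * y)) = _
        rw [map_mul]
        exact leftMul_mul _ _))
    (AlgHom.ofLinearMap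
      (rightMul ℂ (Sphere N q) (Gamma N q s) (Oq N q) ∘ₗ (coaction N q).toLinearMap ∘ₗ
        (MulOpposite.opLinearEquiv ℂ).symm.toLinearMap)
      (by
        change rightMul _ _ _ _ (coaction N q 1) = _
        rw [map_one]
        exact rightMul_one)
      (fun x y => by
        change rightMul _ _ _ _ (coaction N q (y.unop * x.unop)) = _
        rw [map_mul]
        exact rightMul_mul _ _))
    (fun x y => leftMul_rightMul_comm _ _)

theorem envAction_envL (x : Sphere N q) : envAction N q s (envL N q x) =
    leftMul ℂ (Sphere N q) (Gamma N q s) (Oq N q) (coaction N q x) := by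
  refine (Algebra.TensorProduct.lift_tmul ..).trans ?_
  rw [map_one, mul_one]
  rfl

theorem envAction_envR (x : Sphere N q) : envAction N q s (envR N q (op x)) =
    rightMul ℂ (Sphere N q) (Gamma N q s) (Oq N q) (coaction N q x) := by
  refine (Algebra.TensorProduct.lift_tmul ..).trans ?_
  rw [map_one, one_mul]
  rfl

/-- The value `(d ⊗ id) (δ x)` of the coaction on forms at `d x`. -/
def coactionD (N : ℕ) (q : ℝ) (s : ℤˣ) : Sphere N q →ₗ[ℂ] Gamma N q s ⊗[ℂ] Oq N q :=
  (gammaCalculus N q s).d.rTensor (Oq N q) ∘ₗ (coaction N q).toLinearMap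

/-- The coaction on the free bimodule of forms, with values in `Γ ⊗ O_q(N)`. -/
def coactionFreeForms (N : ℕ) (q : ℝ) (s : ℤˣ) :
    FreeForms N q →ₗ[ℂ] Gamma N q s ⊗[ℂ] Oq N q :=
  Finsupp.lsum ℂ fun x : Sphere N q =>
    (envAction N q s).toLinearMap.flip (coactionD N q s x)

theorem coactionFreeForms_symb (x : Sphere N q) :
    coactionFreeForms N q s (FreeForms.symb x) = coactionD N q s x := by
  refine (Finsupp.lsum_single ..).trans ?_
  simp

/-- Semilinearity makes the kernel a sub-bimodule, so that only the generating relations have to be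
checked. -/
theorem coactionFreeForms_smul (e : Env N q) (z : FreeForms N q) :
    coactionFreeForms N q s (e • z) = envAction N q s e (coactionFreeForms N q s z) := by
  induction z using Finsupp.induction_linear with
  | zero =>
    change coactionFreeForms N q s (e • (0 : FreeForms N q)) =
      envAction N q s e (coactionFreeForms N q s (0 : FreeForms N q))
    simp
  | add f g hf hg =>
    -- The induction supplies bare `Finsupp` terms; restating over `FreeForms` fixes the module
    -- structure being used.
    have h : ∀ f g : FreeForms N q,
        coactionFreeForms N q s (e • f) = envAction N q s e (coactionFreeForms N q s f) →
        coactionFreeForms N q s (e • g) = envAction N q s e (coactionFreeForms N q s g) →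
        coactionFreeForms N q s (e • (f + g)) =
          envAction N q s e (coactionFreeForms N q s (f + g)) := by
      intro f g hf hg
      rw [smul_add, map_add, map_add, map_add, hf, hg]
    exact h f g hf hg
  | single x a =>
    have h1 : (e • Finsupp.single x a : Sphere N q →₀ Env N q) = Finsupp.single x (e * a) := by
      simp
    have h2 : ∀ b : Env N q, coactionFreeForms N q s (Finsupp.single x b : Sphere N q →₀ Env N q) =
        envAction N q s b (coactionD N q s x) := fun b => Finsupp.lsum_single ..
    refine (congrArg _ h1).trans ((h2 _).trans ?_)
    refine Eq.trans ?_ (congrArg _ (h2 _).symm)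
    rw [map_mul]
    rfl

theorem coactionFreeForms_left_smul (x : Sphere N q) (z : FreeForms N q) :
    coactionFreeForms N q s (x • z) = leftMul ℂ (Sphere N q) (Gamma N q s) (Oq N q)
      (coaction N q x) (coactionFreeForms N q s z) := by
  rw [← envAction_envL]
  exact coactionFreeForms_smul _ z

theorem coactionFreeForms_right_smul (x : Sphere N q) (z : FreeForms N q) :
    coactionFreeForms N q s (op x • z) = rightMul ℂ (Sphere N q) (Gamma N q s) (Oq N q)
      (coaction N q x) (coactionFreeForms N q s z) := by
  rw [← envAction_envR]
  exact coactionFreeForms_smul _ z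

theorem coactionFreeForms_x_symb (i j : Fin N) :
    coactionFreeForms N q s (Sphere.x q i • FreeForms.symb (Sphere.x q j)) =
      ∑ a, ∑ b, (Sphere.x q a • (gammaCalculus N q s).d (Sphere.x q b)) ⊗ₜ[ℂ]
        (Oq.u q a i * Oq.u q b j) := by
  rw [coactionFreeForms_left_smul, coactionFreeForms_symb, ← leftMul_coaction_d]
  rfl

theorem sum_C_coactionFreeForms_symb :
    ∑ k, ∑ l, (C q k l : ℂ) •
      coactionFreeForms N q s (Sphere.x q k • FreeForms.symb (Sphere.x q l)) =
        eta (gammaCalculus N q s) ⊗ₜ[ℂ] 1 := by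
  simp only [← sum_C_leftMul_coaction_d, coactionFreeForms_x_symb, leftMul_coaction_d]

/-- Since `R̂⁻` intertwines `u ⊗ u`, contracting with it can be carried over from the coacted
indices to the forms. -/
theorem sum_Rm_coactionFreeForms_symb (i j : Fin N) :
    ∑ k, ∑ l, (Rm q k l i j : ℂ) •
      coactionFreeForms N q s (Sphere.x q k • FreeForms.symb (Sphere.x q l)) =
        ∑ a, ∑ b, (∑ k, ∑ l, (Rm q k l a b : ℂ) •
          (Sphere.x q k • (gammaCalculus N q s).d (Sphere.x q l))) ⊗ₜ[ℂ]
            (Oq.u q a i * Oq.u q b j) := by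
  simp only [coactionFreeForms_x_symb]
  rw [Oq.sum_smul_comm]
  simp only [← TensorProduct.tmul_smul, ← TensorProduct.tmul_sum, sum_R_u]
  have h := Oq.sum_smul_comm (fun _ _ : Fin N => (1 : ℂ)) fun a b k l =>
    ((Rm q a b k l : ℂ) • Sphere.x q a • (gammaCalculus N q s).d (Sphere.x q b)) ⊗ₜ[ℂ]
      (Oq.u q k i * Oq.u q l j)
  simp only [one_smul] at h
  simp only [TensorProduct.sum_tmul, TensorProduct.tmul_sum, TensorProduct.tmul_smul,
    TensorProduct.smul_tmul'] at h ⊢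
  exact h

/-- Each term of (*) is equivariant: the `R̂⁻` term by the RTT relations, the `K` term by both
orthogonality relations, and the last one because η is invariant and the coaction is multiplicative.
-/
theorem coactionFreeForms_bimodule (i j : Fin N) :
    coactionFreeForms N q s (op (Sphere.x q j) • FreeForms.symb (Sphere.x q i)) =
      coactionFreeForms N q s (bimoduleRHS s FreeForms.symb i j) := by
  -- The target is built on the quotient, where (*) already holds and can be applied to `dx_a ·
  -- x_b`.
  have hL : coactionFreeForms N q s (op (Sphere.x q j) • FreeForms.symb (Sphere.x q i)) =
      ∑ a, ∑ b, bimoduleRHS s (gammaCalculus N q s).d a b ⊗ₜ[ℂ] (Oq.u q a i * Oq.u q b j) := by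
    rw [coactionFreeForms_right_smul, coactionFreeForms_symb, coactionD, LinearMap.comp_apply,
      AlgHom.toLinearMap_apply]
    simp only [coaction_x, map_sum, LinearMap.sum_apply, LinearMap.rTensor_tmul, rightMul_tmul,
      gammaCalculus_bimodule N q s _ _]
  have hC : ∑ a, ∑ b, ((C q a b : ℂ) • eta (gammaCalculus N q s)) ⊗ₜ[ℂ]
      (Oq.u q a i * Oq.u q b j) = (C q i j : ℂ) • (eta (gammaCalculus N q s) ⊗ₜ[ℂ] 1) := by
    simp only [TensorProduct.smul_tmul, ← TensorProduct.tmul_sum, Oq.orth',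
      Algebra.algebraMap_eq_smul_one]
    rw [TensorProduct.tmul_smul]
  have hK : ∑ k, ∑ l, (K q k l i j : ℂ) •
      coactionFreeForms N q s (Sphere.x q k • FreeForms.symb (Sphere.x q l)) =
      (C q i j : ℂ) • (eta (gammaCalculus N q s) ⊗ₜ[ℂ] 1) := by
    simp only [K, Complex.ofReal_mul, mul_smul, ← Finset.smul_sum, sum_C_coactionFreeForms_symb]
  have hE : ∑ k, ∑ l, (C q k l : ℂ) • coactionFreeForms N q s
      ((Sphere.x q i * Sphere.x q j * Sphere.x q k) • FreeForms.symb (Sphere.x q l)) =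
      ∑ a, ∑ b, ((Sphere.x q a * Sphere.x q b) • eta (gammaCalculus N q s)) ⊗ₜ[ℂ]
        (Oq.u q a i * Oq.u q b j) := by
    simp only [mul_smul (Sphere.x q i * Sphere.x q j),
      coactionFreeForms_left_smul (Sphere.x q i * Sphere.x q j), ← map_smul, ← map_sum]
    simp only [map_smul, map_sum, sum_C_coactionFreeForms_symb]
    simp [coaction_x, Finset.sum_mul_sum, LinearMap.sum_apply]
  rw [hL]
  -- The scalar patterns extract just the outer coefficients of (*), while the entries of `R̂⁻` and
  -- `C` stay inside the sums.
  simp only [bimoduleRHS_eq, TensorProduct.add_tmul, Finset.sum_add_distrib,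
    ← TensorProduct.smul_tmul' (sgn s : ℂ), ← TensorProduct.smul_tmul' (Complex.ofReal (_ - _)),
    ← TensorProduct.smul_tmul' (Complex.ofReal (_ / _)), ← Finset.smul_sum]
  rw [hC, ← hE, ← hK, ← sum_Rm_coactionFreeForms_symb, ← coactionFreeForms_x_symb]
  simp only [bimoduleRHS, map_add, map_smul, map_sum]

theorem coactionFreeForms_rel {z : FreeForms N q} (h : GammaRel N q s z) :
    coactionFreeForms N q s z = 0 := by
  cases h with
  | add x y => simp [coactionFreeForms_symb]
  | smul a x => simp [coactionFreeForms_symb]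
  | leibniz x y =>
    rw [map_sub, map_add, coactionFreeForms_left_smul, coactionFreeForms_right_smul, sub_eq_zero]
    simp only [coactionFreeForms_symb, coactionD, LinearMap.comp_apply, AlgHom.toLinearMap_apply,
      map_mul]
    exact (gammaCalculus N q s).rTensor_mul _ _
  | bimodule i j => rw [map_sub, coactionFreeForms_bimodule, sub_self]

theorem coactionFreeForms_relations {z : FreeForms N q} (h : z ∈ gammaRelations N q s) :
    coactionFreeForms N q s z = 0 := by
  induction h using Submodule.span_induction with
  | mem z h => exact coactionFreeForms_rel h
  | zero => simp
  | add a b _ _ ha hb => rw [map_add, ha, hb, add_zero]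
  | smul e z _ hz => rw [coactionFreeForms_smul, hz, map_zero]

/-- The coaction on one-forms. -/
def coactionForms (N : ℕ) (q : ℝ) (s : ℤˣ) : Gamma N q s →ₗ[ℂ] Gamma N q s ⊗[ℂ] Oq N q :=
  ((gammaRelations N q s).restrictScalars ℂ).liftQ (coactionFreeForms N q s)
    (fun _ h => coactionFreeForms_relations h) ∘ₗ
  (Submodule.Quotient.restrictScalarsEquiv ℂ (gammaRelations N q s)).symm.toLinearMap

theorem coactionForms_mk (z : FreeForms N q) :
    coactionForms N q s (mk N q s z) = coactionFreeForms N q s z := rfl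

theorem isCovarianceMap_coactionForms :
    (gammaCalculus N q s).IsCovarianceMap (coaction N q) (coactionForms N q s) := by
  refine (gammaCalculus N q s).isCovarianceMap_of_map_smul coaction_coassoc coaction_counit
    (fun x => coactionFreeForms_symb x) fun x y ω => ?_
  obtain ⟨z, rfl⟩ := (gammaRelations N q s).mkQ_surjective ω
  change coactionForms N q s (mk N q s (x • op y • z)) =
    leftMul _ _ _ _ _ (rightMul _ _ _ _ _ (coactionForms N q s (mk N q s z)))
  rw [coactionForms_mk, coactionForms_mk, coactionFreeForms_left_smul,
    coactionFreeForms_right_smul]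

end Gamma

end QSphere

end


theorem mainTheorem8 (N : ℕ) (hN : 3 ≤ N) (q : ℝ) (hq : 0 < q) (hq1 : q ≠ 1) (s : ℤˣ) :
    -- every free covariant calculus with the bimodule structure of `Γ₊` resp. `Γ₋` is inner
    (∀ (Γ : Type*) [AddCommGroup Γ] [Module ℂ Γ] [Module (Sphere N q) Γ]
        [Module (Sphere N q)ᵐᵒᵖ Γ] [IsScalarTower ℂ (Sphere N q) Γ]
        [IsScalarTower ℂ (Sphere N q)ᵐᵒᵖ Γ] [SMulCommClass (Sphere N q) (Sphere N q)ᵐᵒᵖ Γ]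
        (c : FODC ℂ (Sphere N q) Γ), IsGamma s c →
      (∀ Φ : Γ →ₗ[ℂ] Γ ⊗[ℂ] Oq N q, c.IsCovarianceMap (coaction N q) Φ →
        IsInvariant Φ (eta c) ∧ IsInvariant Φ (eta' s c)) ∧
      (∀ x : Sphere N q, c.d x = MulOpposite.op x • eta' s c - x • eta' s c) ∧
      c.IsInner (coaction N q)) ∧
    -- the calculus presented by generators and relations is covariant and inner
    ((∃ Φ : Gamma N q s →ₗ[ℂ] Gamma N q s ⊗[ℂ] Oq N q,
        (gammaCalculus N q s).IsCovarianceMap (coaction N q) Φ ∧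
        IsInvariant Φ (eta (gammaCalculus N q s)) ∧
        IsInvariant Φ (eta' s (gammaCalculus N q s))) ∧
      (∀ x : Sphere N q, (gammaCalculus N q s).d x =
        MulOpposite.op x • eta' s (gammaCalculus N q s) - x • eta' s (gammaCalculus N q s)) ∧
      (gammaCalculus N q s).IsInner (coaction N q)) := by
  have hΦ := Gamma.isCovarianceMap_coactionForms (N := N) (q := q) (s := s)
  have hd := d_eq_commutator hN hq hq1 (gammaCalculus_bimodule N q s)
  refine ⟨fun Γ _ _ _ _ _ _ _ c hc => ?_, ⟨_, hΦ, isInvariant_eta hΦ, isInvariant_eta' s hΦ⟩, hd,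
    _, hΦ, _, isInvariant_eta' s hΦ, hd⟩
  have hdc := d_eq_commutator hN hq hq1 hc.bimodule
  obtain ⟨Ψ, hΨ⟩ := hc.covariant
  exact ⟨fun Φ h => ⟨isInvariant_eta h, isInvariant_eta' s h⟩, hdc,
    Ψ, hΨ, _, isInvariant_eta' s hΨ, hdc⟩
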